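/- Let $0\le P<L$ be integers and $0\le v<1$. Consider the totally asymmetric exclusion process with parallel update of $P$ particles on a ring of $L$ sites $1,\dots,L$ (site $1$ follows site $L$). A configuration is $X=(x_1,\dots,x_P)\in\mathbb Z^P$ with $1\le x_1<\dots<x_P\le L$. At each step of discrete time, simultaneously and independently, every particle whose next site is vacant moves one site forward with probability $v$ and stays with probability $1-v$; a particle whose next site is occupied stays. Let $P(X;t|X^0;0)$ be the probability of being in configuration $X$ after $t$ steps started from $X^0$, and $P_t(X,J;t|X^0,0;0)$ the joint probability of being in $X$ after $t$ steps and of a total distance $J$ (the total number of jumps) travelled by the particles up to time $t$. Let $\mathcal N_c(X)$ be the number of clusters of $X$ (maximal groups of particles on consecutive sites of the ring). For $a,b\in\mathbb Z$ and $t\in\mathbb Z_{\ge0}$, with $(c)_n=c(c+1)\cdots(c+n-1)$, put $$f(a,b,t)=(1-v)^t\begin{cases}\left(\frac{v}{v-1}\right)^{b}\frac{(-t-a)_b}{b!}\,{}_2F_1\!\left(a,\,-t-a+b;\,b+1;\,\frac{v}{v-1}\right), & b>0,\\[1ex] \frac{(a)_{-b}}{(-b)!}\,{}_2F_1\!\left(a-b,\,-t-a;\,-b+1;\,\frac{v}{v-1}\right),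 & b\le 0,\end{cases}$$ where each expression is read as $0$ when its prefactor $(-t-a)_b$, respectively $(a)_{-b}$, vanishes; otherwise the hypergeometric series terminates. For $X,Y\in\mathbb Z^P$ and $n\in\mathbb Z^P$ put $$D_n(X,Y,t)=(-1)^{(P-1)\sum_{i}n_i}\det\Big[f\Big(i-j+Pn_i-\sum_{k=1}^P n_k,\;x_i-y_j+n_iL,\;t\Big)\Big]_{1\le i,j\le P},\qquad \mathcal F_L(X,Y,t)=\sum_{n\in\mathbb Z^P}D_n(X,Y,t).$$ Then: 1. For all configurations $X,Y$ and all $t\ge0$, only finitely many of the terms $D_n(X,Y,t)$, $n\in\mathbb Z^P$, are nonzero. 2. For every configuration $X$, $\mathcal F_L(X,X,0)=(1-v)^{\mathcal N_c(X)-P}$. Likewise, on the infinite lattice, for all integers $x_1<\dots<x_P$, $\det[f(i-j,x_i-x_j,0)]_{1\le i,j\le P}=(1-v)^{\mathcal N_c^{\infty}(X)-P}$, where $\mathcal N^\infty_c(X)$ is the number of clusters of $X$ on $\mathbb Z$. 3. For all configurations $X,X^0$ and all $t\ge0$, $$P(X;t|X^0;0)=\frac{\mathcal F_L(X,X^0,t)}{\mathcal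 F_L(X,X,0)}.$$ 4. For all configurations $X,X^0$, all $t\ge0$ and all $\gamma\in\mathbb R$, $$\sum_{J=0}^\infty e^{\gamma J}\,P_t(X,J;t|X^0,0;0)=\frac{1}{\mathcal F_L(X,X,0)}\sum_{n\in\mathbb Z^P}e^{\gamma\sum_{j=1}^P(x_j-x^0_j+Ln_j)}\,D_n(X,X^0,t).$$ -/

import Mathlib

open Finset

/-- The function `f(a, b, t)` written with the Gauss hypergeometric function; the shifted
factorial `(c)_n = c (c + 1) ⋯ (c + n - 1)` is `(ascPochhammer ℝ n).eval c`.  For `t ∈ ℕ` and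
integers `a`, `b`, in either case the prefactor `(c)_n` vanishes or the hypergeometric series
terminates. -/
noncomputable def tasepF (v : ℝ) (a b : ℤ) (t : ℕ) : ℝ :=
  (1 - v) ^ t *
    if 0 < b then
      (v / (v - 1)) ^ b.toNat * ((ascPochhammer ℝ b.toNat).eval (-(t : ℝ) - a) / b.toNat.factorial)
        * ₂F₁ (a : ℝ) (-(t : ℝ) - a + b) ((b : ℝ) + 1) (v / (v - 1))
    else
      (ascPochhammer ℝ (-b).toNat).eval (a : ℝ) / (-b).toNat.factorial
        * ₂F₁ ((a : ℝ) - b) (-(t : ℝ) - a) (-(b : ℝ) + 1) (v / (v - 1))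

/-! ### The model on the ring -/

open Classical in
/-- Configurations of `P` particles on the ring with sites `1, …, L`:
`1 ≤ x₁ < x₂ < ⋯ < x_P ≤ L`. -/
noncomputable def ringConfigs (P L : ℕ) : Finset (Fin P → ℤ) :=
  {X ∈ Fintype.piFinset fun _ : Fin P => Finset.Icc (1 : ℤ) L | StrictMono X}

/-- The set of occupied sites, as residues modulo `L`. -/
def occupiedSites {P : ℕ} (L : ℕ) (X : Fin P → ℤ) : Finset (ZMod L) :=
  univ.image fun i => (X i : ZMod L)

/-- The particles whose next site on the ring is vacant.  Each cluster contains exactly one of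
them, its first (frontmost) particle. -/
def frontParticles {P : ℕ} (L : ℕ) (X : Fin P → ℤ) : Finset (Fin P) :=
  {i | ((X i + 1 : ℤ) : ZMod L) ∉ occupiedSites L X}

/-- The number of clusters of a configuration on the ring. -/
def numClusters {P : ℕ} (L : ℕ) (X : Fin P → ℤ) : ℕ :=
  (frontParticles L X).card

/-- The number of clusters of a configuration on the infinite lattice. -/
def numClustersInf {P : ℕ} (X : Fin P → ℤ) : ℕ :=
  (univ.filter fun i : Fin P => ∀ k, X k ≠ X i + 1).card

/-- The sets `S` of particles, all of them allowed to jump from `X'`, such that `X'` becomes `X`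
when exactly the particles of `S` make one step forward. -/
def jumpSets {P : ℕ} (L : ℕ) (X X' : Fin P → ℤ) : Finset (Finset (Fin P)) :=
  {S ∈ (frontParticles L X').powerset |
    occupiedSites L (fun i => X' i + if i ∈ S then 1 else 0) = occupiedSites L X}

/-- The probability that, among the particles of `X'` that may jump, exactly those of `S` do:
a factor `v` or `1 - v` for every cluster. -/
noncomputable def jumpWeight {P : ℕ} (L : ℕ) (v : ℝ) (X' : Fin P → ℤ) (S : Finset (Fin P)) : ℝ :=
  ∏ i ∈ frontParticles L X', if i ∈ S then v else 1 - v

/-- The one-step transition probability `T(X, X')` from `X'` to `X`. -/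
noncomputable def stepProb {P : ℕ} (L : ℕ) (v : ℝ) (X X' : Fin P → ℤ) : ℝ :=
  ∑ S ∈ jumpSets L X X', jumpWeight L v X' S

/-- The transition probability `P(X; t | X⁰; 0)`, through the Markov equation. -/
noncomputable def transProb {P : ℕ} (L : ℕ) (v : ℝ) (X₀ : Fin P → ℤ) : ℕ → (Fin P → ℤ) → ℝ
  | 0, X => if X = X₀ then 1 else 0
  | t + 1, X => ∑ X' ∈ ringConfigs P L, stepProb L v X X' * transProb L v X₀ t X'

/-- The joint probability `P(X, J; t | X⁰, 0; 0)` of being in the configuration `X` at time `t`,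
the particles having travelled the total distance `J` (that is, having made `J` jumps in all). -/
noncomputable def jointProb {P : ℕ} (L : ℕ) (v : ℝ) (X₀ : Fin P → ℤ) :
    ℕ → (Fin P → ℤ) → ℕ → ℝ
  | 0, X, J => if X = X₀ ∧ J = 0 then 1 else 0
  | t + 1, X, J => ∑ X' ∈ ringConfigs P L, ∑ S ∈ jumpSets L X X',
      if S.card ≤ J then jumpWeight L v X' S * jointProb L v X₀ t X' (J - S.card) else 0

/-! ### The determinants -/

/-- The determinant `det [f(i - j, x_i - y_j, t)]` of the infinite lattice. -/
noncomputable def detInf {P : ℕ} (v : ℝ) (X Y : Fin P → ℤ) (t : ℕ) : ℝ :=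
  Matrix.det (Matrix.of fun i j : Fin P => tasepF v ((i : ℤ) - (j : ℤ)) (X i - Y j) t)

/-- The summand of `F_L(X, Y, t)` with winding numbers `n`. -/
noncomputable def ringTerm {P : ℕ} (L : ℕ) (v : ℝ) (X Y : Fin P → ℤ) (t : ℕ)
    (n : Fin P → ℤ) : ℝ :=
  (-1 : ℝ) ^ (((P : ℤ) - 1) * ∑ i, n i) *
    Matrix.det (Matrix.of fun i j : Fin P =>
      tasepF v ((i : ℤ) - (j : ℤ) + P * n i - ∑ k, n k) (X i - Y j + n i * L) t)

/-- `F_L(X, Y, t)`. -/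
noncomputable def ringF {P : ℕ} (L : ℕ) (v : ℝ) (X Y : Fin P → ℤ) (t : ℕ) : ℝ :=
  ∑' n : Fin P → ℤ, ringTerm L v X Y t n

/-- `F_L` with its summands weighted by `exp (γ ∑ (x_j - y_j + L n_j))`. -/
noncomputable def ringGenF {P : ℕ} (L : ℕ) (v γ : ℝ) (X Y : Fin P → ℤ) (t : ℕ) : ℝ :=
  ∑' n : Fin P → ℤ,
    Real.exp (γ * ((∑ j, (X j - Y j + L * n j) : ℤ) : ℝ)) * ringTerm L v X Y t n

/-!
# Determinant formulas for the parallel-update exclusion process on a ring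

**The function `f`.** With `lam = v / (v - 1)`, `f(a, b, t)` is `(1 - v) ^ t` times the
coefficient of `z ^ b` in `(1 - 1 / z) ^ (-a) * (1 - lam * z) ^ (t + a)`, a finite convolution
because one of the two factors is a polynomial (`tasepF_eq_conv`).  Multiplying by either factor
gives the free evolution `tasepF_succ` and the relation `tasepF_succ_eq_add`,
`f(a, b, t + 1) = f(a, b, t) + v / (1 - v) * f(a - 1, b - 1, t + 1)`.

**Determinants.** All the sums over winding numbers are instances of `ringSum`, whose rows are
arbitrary functions of level and position; the weight `exp (γ * distance)` is absorbed into the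
rows.  The levels of the rows in a nonzero term add up to `0`, and `P < L` then bounds the winding
numbers (`bounded_winding`).  If the rows of two particles that are neighbours on the ring are
proportional, the sum vanishes, since exchanging their winding numbers exchanges two rows
(`ringSum_eq_zero_of_neighbours`).  Hence, wherever a particle sits directly in front of another
one whose row is taken at time `t + 1`, its own row at time `t + 1` may be replaced by that at
time `t`.  Doing so from the front of each cluster backwards leaves one moving particle per
cluster, the last one (`ringSum_mixedRows_univ`); this is exactly the exclusion rule read
backwards in time (`weightedRingF_succ`).  The sets of last particles of clusters of `X` correspond to the possible
last steps leading to `X`, up to the cyclic relabelling of particles, under which the sum is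
invariant (`sum_jumpSets_succ`, `ringSum_relabel`).  The weights agree after division by
`(1 - v) ^ (numClusters L X - P)`, which gives the Markov equation (`weightedRingF_div_succ`).

**Initial condition.** At time `0` the same elimination is carried out once more.  A nonzero term
of the Leibniz expansion then matches rows with columns; extended periodically, this is a
matching of `ℤ` with itself without net flow across any point.  Where the two configurations
differ, the support of `f` would force all pairs to cross in the same direction
(`eq_of_matching`), so they agree, and only the identity without winding survives
(`eq_of_forall_ne_zero`).  On the infinite lattice the eliminated matrix is upper triangular.
-/

/-! ### The function `f` as a finite convolution -/

/-- The coefficient `(α)_m / m!` of `x ^ m` in the power series of `(1 - x) ^ (-α)`, extended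
by `0` to negative `m`. -/
noncomputable def pochCoeff (α : ℝ) (m : ℤ) : ℝ :=
  if m < 0 then 0 else (ascPochhammer ℝ m.toNat).eval α / m.toNat.factorial

lemma pochCoeff_of_neg (α : ℝ) {m : ℤ} (hm : m < 0) : pochCoeff α m = 0 := if_pos hm

lemma pochCoeff_natCast (α : ℝ) (m : ℕ) :
    pochCoeff α m = (ascPochhammer ℝ m).eval α / m.factorial := by
  simp [pochCoeff]

/-- Multiplication by `1 - x`. -/
lemma pochCoeff_sub (α : ℝ) (m : ℤ) :
    pochCoeff (α + 1) m - pochCoeff (α + 1) (m - 1) = pochCoeff α m := by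
  rcases lt_trichotomy m 0 with h | rfl | h
  · simp [pochCoeff_of_neg, h, show m - 1 < 0 by omega]
  · rw [pochCoeff_of_neg _ (show (0 : ℤ) - 1 < 0 by omega)]
    simp [pochCoeff]
  · obtain ⟨k, rfl⟩ : ∃ k : ℕ, m = (k : ℤ) + 1 := ⟨(m - 1).toNat, by omega⟩
    have e : ((k : ℤ) + 1) = ((k + 1 : ℕ) : ℤ) := by push_cast; ring
    rw [add_sub_cancel_right, e, pochCoeff_natCast, pochCoeff_natCast, pochCoeff_natCast,
      Nat.factorial_succ, ascPochhammer_succ_eval]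
    have e2 : (ascPochhammer ℝ (k + 1)).eval α = α * (ascPochhammer ℝ k).eval (α + 1) := by
      simp [ascPochhammer_succ_left, Polynomial.eval_comp]
    rw [e2]
    have : (k.factorial : ℝ) ≠ 0 := by exact_mod_cast k.factorial_ne_zero
    have : (k : ℝ) + 1 ≠ 0 := by positivity
    push_cast
    field_simp
    ring

lemma pochCoeff_eq_zero_of_lt {a m : ℤ} (ha : a ≤ 0) (hm : -a < m) : pochCoeff a m = 0 := by
  obtain ⟨k, rfl⟩ : ∃ k : ℕ, a = -(k : ℤ) := ⟨(-a).toNat, by omega⟩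
  obtain ⟨n, rfl⟩ : ∃ n : ℕ, m = (n : ℤ) := ⟨m.toNat, by omega⟩
  rw [pochCoeff_natCast]
  push_cast
  rw [ascPochhammer_eval_neg_coe_nat_of_lt (by omega), zero_div]

/-- The coefficient of `z ^ n` in the power series of `(1 - lam * z) ^ s`. -/
noncomputable def binomCoeff (lam : ℝ) (s n : ℤ) : ℝ :=
  lam ^ n.toNat * pochCoeff (-(s : ℝ)) n

lemma binomCoeff_succ (lam : ℝ) (s n : ℤ) :
    binomCoeff lam (s + 1) n = binomCoeff lam s n - lam * binomCoeff lam s (n - 1) := by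
  have h := pochCoeff_sub (-((s : ℝ) + 1)) n
  rw [show -((s : ℝ) + 1) + 1 = -s by ring] at h
  unfold binomCoeff
  push_cast
  rw [← h]
  rcases le_or_gt n 0 with hn | hn
  · rw [pochCoeff_of_neg _ (show n - 1 < 0 by omega)]
    ring
  · rw [show n.toNat = (n - 1).toNat + 1 by omega]
    ring

lemma binomCoeff_of_neg (lam : ℝ) (s : ℤ) {n : ℤ} (hn : n < 0) : binomCoeff lam s n = 0 := by
  rw [binomCoeff, pochCoeff_of_neg _ hn, mul_zero]

lemma binomCoeff_eq_zero_of_lt (lam : ℝ) {s n : ℤ} (hs : 0 ≤ s) (hn : s < n) :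
    binomCoeff lam s n = 0 := by
  rw [binomCoeff, show (-(s : ℝ)) = ((-s : ℤ) : ℝ) by push_cast; ring,
    pochCoeff_eq_zero_of_lt (by omega) (by omega), mul_zero]

/-- The terms of the coefficient of `z ^ b` in `(1 - 1 / z) ^ (-a) * (1 - lam * z) ^ s`. -/
noncomputable def convTerm (lam : ℝ) (a b s n : ℤ) : ℝ :=
  pochCoeff a (n - b) * binomCoeff lam s n

/-- One of the two factors is a polynomial as soon as `a ≤ 0` or `0 ≤ s`. -/
lemma summable_convTerm (lam : ℝ) {a s : ℤ} (b : ℤ) (h : a ≤ 0 ∨ 0 ≤ s) :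
    Summable (convTerm lam a b s) := by
  refine summable_of_hasFiniteSupport
    ((Set.finite_Icc (0 : ℤ) (max (b - a) s)).subset fun n hn => ?_)
  rw [Function.mem_support] at hn
  by_contra hc
  refine hn ?_
  rw [Set.mem_Icc, not_and_or, not_le, not_le, max_lt_iff] at hc
  rcases hc with hc | hc
  · rw [convTerm, binomCoeff_of_neg _ _ hc, mul_zero]
  · rcases h with h | h
    · rw [convTerm, pochCoeff_eq_zero_of_lt h (by omega), zero_mul]
    · rw [convTerm, binomCoeff_eq_zero_of_lt _ h (by omega), mul_zero]

/-- The convolution of the two coefficient sequences. -/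
noncomputable def conv (lam : ℝ) (a b s : ℤ) : ℝ := ∑' n, convTerm lam a b s n

lemma conv_succ_right (lam : ℝ) {a s : ℤ} (b : ℤ) (h : a ≤ 0 ∨ 0 ≤ s) :
    conv lam a b (s + 1) = conv lam a b s - lam * conv lam a (b - 1) s := by
  have h1 : conv lam a (b - 1) s = ∑' n, convTerm lam a (b - 1) s (n - 1) :=
    ((Equiv.subRight (1 : ℤ)).tsum_eq _).symm
  have s1 : Summable fun n => convTerm lam a (b - 1) s (n - 1) :=
    (Equiv.subRight (1 : ℤ)).summable_iff.mpr (summable_convTerm lam (b - 1) h)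
  rw [h1, conv, conv, ← tsum_mul_left, ← (summable_convTerm lam b h).tsum_sub (s1.mul_left lam)]
  refine tsum_congr fun n => ?_
  rw [convTerm, convTerm, convTerm, binomCoeff_succ, show n - 1 - (b - 1) = n - b by ring]
  ring

lemma conv_sub_left (lam : ℝ) {a s : ℤ} (b : ℤ) (h : a + 1 ≤ 0 ∨ 0 ≤ s) :
    conv lam (a + 1) b s - conv lam (a + 1) (b + 1) s = conv lam a b s := by
  rw [conv, conv, ← (summable_convTerm lam b h).tsum_sub (summable_convTerm lam (b + 1) h), conv]
  refine tsum_congr fun n => ?_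
  have := pochCoeff_sub (a : ℝ) (n - b)
  rw [convTerm, convTerm, convTerm, ← this, show n - (b + 1) = n - b - 1 by ring]
  push_cast
  ring

lemma tasepF_eq_conv (v : ℝ) (a b : ℤ) (t : ℕ) :
    tasepF v a b t = (1 - v) ^ t * conv (v / (v - 1)) a b (t + a) := by
  have key : ∀ (k m : ℕ) (x : ℝ), (ascPochhammer ℝ (k + m)).eval x =
      (ascPochhammer ℝ k).eval x * (ascPochhammer ℝ m).eval (x + k) := by
    intro k m x
    rw [← ascPochhammer_mul]
    simp [Polynomial.eval_comp]
  have fact : ∀ k m : ℕ, ((k + m).factorial : ℝ) =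
      k.factorial * (ascPochhammer ℝ m).eval ((k : ℝ) + 1) := by
    intro k m
    exact (factorial_mul_ascPochhammer ℝ k m).symm
  have pos : ∀ k m : ℕ, (ascPochhammer ℝ m).eval ((k : ℝ) + 1) ≠ 0 := fun k m =>
    (ascPochhammer_pos m _ (by positivity)).ne'
  unfold tasepF conv
  congr 1
  set lam := v / (v - 1)
  split_ifs with hb
  · obtain ⟨k, rfl⟩ : ∃ k : ℕ, b = (k : ℤ) := ⟨b.toNat, by omega⟩
    have inj : Function.Injective fun m : ℕ => ((k : ℤ) + m) := fun x y h => by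
      simpa using h
    rw [← inj.tsum_eq, ordinaryHypergeometric_eq_tsum]
    · rw [Int.toNat_natCast, ← tsum_mul_left]
      refine tsum_congr fun m => ?_
      rw [convTerm, binomCoeff, add_sub_cancel_left, pochCoeff_natCast,
        show ((k : ℤ) + m) = ((k + m : ℕ) : ℤ) by push_cast; ring, pochCoeff_natCast, key,
        Int.toNat_natCast, fact]
      have := pos k m
      have h3 : (k.factorial : ℝ) ≠ 0 := by exact_mod_cast k.factorial_ne_zero
      have h4 : (m.factorial : ℝ) ≠ 0 := by exact_mod_cast m.factorial_ne_zero
      push_cast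
      rw [show -((t : ℝ) + a) + k = -t - a + k by ring, show -((t : ℝ) + a) = -t - a by ring,
        smul_eq_mul]
      field_simp
      ring
    · intro n hn
      rw [Function.mem_support] at hn
      rcases lt_or_ge n k with h | h
      · exact absurd (by rw [convTerm, pochCoeff_of_neg _ (by omega), zero_mul]) hn
      · exact ⟨(n - k).toNat, by dsimp only; omega⟩
  · obtain ⟨k, rfl⟩ : ∃ k : ℕ, b = -(k : ℤ) := ⟨(-b).toNat, by omega⟩
    have inj : Function.Injective fun m : ℕ => (m : ℤ) := fun x y h => by
      simpa using h
    rw [← inj.tsum_eq, ordinaryHypergeometric_eq_tsum]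
    · rw [neg_neg, Int.toNat_natCast, ← tsum_mul_left]
      refine tsum_congr fun m => ?_
      rw [convTerm, binomCoeff, show ((m : ℤ) - -(k : ℤ)) = ((k + m : ℕ) : ℤ) by push_cast; ring,
        pochCoeff_natCast, pochCoeff_natCast, key, Int.toNat_natCast, fact]
      have := pos k m
      have h3 : (k.factorial : ℝ) ≠ 0 := by exact_mod_cast k.factorial_ne_zero
      have h4 : (m.factorial : ℝ) ≠ 0 := by exact_mod_cast m.factorial_ne_zero
      push_cast
      rw [show -((t : ℝ) + a) = -t - a by ring, smul_eq_mul, sub_neg_eq_add, neg_neg]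
      field_simp
    · intro n hn
      rw [Function.mem_support] at hn
      rcases lt_or_ge n 0 with h | h
      · exact absurd (by rw [convTerm, binomCoeff_of_neg _ _ h, mul_zero]) hn
      · exact ⟨n.toNat, by dsimp only; omega⟩

/-- One time step moves a free particle with probability `v`. -/
lemma tasepF_succ {v : ℝ} (hv : v < 1) (a b : ℤ) (t : ℕ) :
    tasepF v a b (t + 1) = (1 - v) * tasepF v a b t + v * tasepF v a (b - 1) t := by
  rw [tasepF_eq_conv, tasepF_eq_conv, tasepF_eq_conv,
    show (((t + 1 : ℕ) : ℤ) + a) = (t + a) + 1 by push_cast; ring,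
    conv_succ_right _ _ (by omega)]
  have : v - 1 ≠ 0 := by linarith
  have e : (1 - v) * (v / (v - 1)) = -v := by field_simp; ring
  linear_combination (-(1 - v) ^ t * conv (v / (v - 1)) a (b - 1) (t + a)) * e

/-- Advancing the time is the same as lowering the first index and taking a difference in
position. -/
lemma tasepF_sub (v : ℝ) (a b : ℤ) (t : ℕ) :
    (1 - v) * (tasepF v (a + 1) b t - tasepF v (a + 1) (b + 1) t) = tasepF v a b (t + 1) := by
  rw [tasepF_eq_conv, tasepF_eq_conv, tasepF_eq_conv,
    show (((t + 1 : ℕ) : ℤ) + a) = t + (a + 1) by push_cast; ring,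
    ← conv_sub_left _ (a := a) b (by omega)]
  ring

/-- The relation behind the exclusion rule: subtracting a multiple of the row of the particle
just behind takes a row from time `t + 1` back to time `t`. -/
lemma tasepF_succ_eq_add {v : ℝ} (hv : v < 1) (a b : ℤ) (t : ℕ) :
    tasepF v a b (t + 1) = tasepF v a b t + v / (1 - v) * tasepF v (a - 1) (b - 1) (t + 1) := by
  have h := tasepF_sub v (a - 1) (b - 1) t
  rw [sub_add_cancel, sub_add_cancel] at h
  rw [← h, tasepF_succ hv]
  have : 1 - v ≠ 0 := by linarith
  field_simp
  ring

lemma tasepF_eq_zero_of_lt (v : ℝ) {a b : ℤ} (t : ℕ) (ha : a ≤ 0) (hb : b < a) :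
    tasepF v a b t = 0 := by
  rw [tasepF_eq_conv, conv]
  convert mul_zero _
  refine (tsum_congr fun n => ?_).trans tsum_zero
  rcases lt_or_ge n 0 with h | h
  · rw [convTerm, binomCoeff_of_neg _ _ h, mul_zero]
  · rw [convTerm, pochCoeff_eq_zero_of_lt ha (by omega), zero_mul]

lemma tasepF_eq_zero_of_gt (v : ℝ) {a b : ℤ} {t : ℕ} (ha : 0 ≤ t + a) (hb : t + a < b) :
    tasepF v a b t = 0 := by
  rw [tasepF_eq_conv, conv]
  convert mul_zero _
  refine (tsum_congr fun n => ?_).trans tsum_zero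
  rcases lt_or_ge n b with h | h
  · rw [convTerm, pochCoeff_of_neg _ (by omega), zero_mul]
  · rw [convTerm, binomCoeff_eq_zero_of_lt _ ha (by omega), mul_zero]

lemma tasepF_zero_zero_zero (v : ℝ) : tasepF v 0 0 0 = 1 := by
  rw [tasepF_eq_conv, conv, tsum_eq_single 0]
  · simp [convTerm, binomCoeff, pochCoeff]
  · intro n hn
    rcases lt_or_ge n 0 with h | h
    · rw [convTerm, pochCoeff_of_neg _ (by omega), zero_mul]
    · rw [convTerm, pochCoeff_eq_zero_of_lt le_rfl (by omega), zero_mul]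

lemma tasepF_neg_one_neg_one_zero {v : ℝ} (hv : v < 1) : tasepF v (-1) (-1) 0 = -1 := by
  have h := tasepF_sub v (-1) (-1) 0
  rw [tasepF_succ hv, tasepF_eq_zero_of_lt v (a := -1) (b := -1 - 1) 0 (by omega) (by omega),
    neg_add_cancel, tasepF_eq_zero_of_lt v (a := 0) (b := -1) 0 le_rfl (by omega),
    tasepF_zero_zero_zero] at h
  have : 1 - v ≠ 0 := by linarith
  exact mul_left_cancel₀ this (by linarith)

/-- At time `0` the extreme values `f(a, a, 0)`, `a ≥ 0`, form a geometric progression. -/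
lemma tasepF_diag_succ {v : ℝ} (hv : v < 1) {a : ℤ} (ha : 0 ≤ a) :
    tasepF v (a + 1) (a + 1) 0 = v / (1 - v) * tasepF v a a 0 := by
  have h := tasepF_sub v a (a + 1) 0
  rw [tasepF_succ hv, tasepF_eq_zero_of_gt v (a := a + 1) (b := a + 1 + 1) (t := 0) (by omega)
    (by omega), tasepF_eq_zero_of_gt v (a := a) (b := a + 1) (t := 0) (by omega) (by omega),
    add_sub_cancel_right] at h
  have : 1 - v ≠ 0 := by linarith
  field_simp
  linarith

/-- A row at time `0` from which the row of the particle just behind has been eliminated. -/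
noncomputable def tasepF₀ (v : ℝ) (a b : ℤ) : ℝ :=
  tasepF v a b 0 - v / (1 - v) * tasepF v (a - 1) (b - 1) 0

lemma tasepF₀_eq_zero_of_lt (v : ℝ) {a b : ℤ} (ha : a ≤ 0) (hb : b < a) : tasepF₀ v a b = 0 := by
  rw [tasepF₀, tasepF_eq_zero_of_lt v 0 ha hb, tasepF_eq_zero_of_lt v 0 (by omega) (by omega)]
  ring

lemma tasepF₀_eq_zero_of_ge {v : ℝ} (hv : v < 1) {a b : ℤ} (ha : 0 < a) (hb : a ≤ b) :
    tasepF₀ v a b = 0 := by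
  rcases hb.eq_or_lt with rfl | hb
  · have := tasepF_diag_succ hv (a := a - 1) (by omega)
    rw [sub_add_cancel] at this
    rw [tasepF₀, this, sub_self]
  · rw [tasepF₀, tasepF_eq_zero_of_gt v (a := a) (t := 0) (by omega) (by omega),
      tasepF_eq_zero_of_gt v (a := a - 1) (t := 0) (by omega) (by omega)]
    ring

lemma tasepF₀_zero_zero {v : ℝ} (hv : v < 1) : tasepF₀ v 0 0 = (1 - v)⁻¹ := by
  rw [tasepF₀, tasepF_zero_zero_zero, zero_sub, tasepF_neg_one_neg_one_zero hv]
  have : 1 - v ≠ 0 := by linarith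
  field_simp
  ring

/-! ### Sums of determinants over winding numbers -/

/-- The matrix with winding numbers `n` built from a function of level and position for each
row: row `i` is taken at the level `i + P * n i - ∑ k, n k` and at the position `n i * L`, and
column `j` subtracts `j` and `Y j` from them. -/
def ringMatrix {P : ℕ} (L : ℕ) (Φ : Fin P → ℤ → ℤ → ℝ) (Y n : Fin P → ℤ) :
    Matrix (Fin P) (Fin P) ℝ :=
  Matrix.of fun i j => Φ i ((i : ℤ) - (j : ℤ) + P * n i - ∑ k, n k) (n i * L - Y j)

/-- The signed determinant with winding numbers `n`. -/
noncomputable def ringSummand {P : ℕ} (L : ℕ) (Φ : Fin P → ℤ → ℤ → ℝ) (Y n : Fin P → ℤ) : ℝ :=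
  (-1 : ℝ) ^ (((P : ℤ) - 1) * ∑ i, n i) * (ringMatrix L Φ Y n).det

/-- The sum of the signed determinants over all winding numbers. -/
noncomputable def ringSum {P : ℕ} (L : ℕ) (Φ : Fin P → ℤ → ℤ → ℝ) (Y : Fin P → ℤ) : ℝ :=
  ∑' n, ringSummand L Φ Y n

/-- A row function of `(a, b)` that vanishes, up to a bounded error in `b`, below the diagonal
`b = a` for `a ≤ 0` and above it for `0 < a`. -/
def RowBanded (φ : ℤ → ℤ → ℝ) : Prop :=
  ∃ C : ℤ, ∀ a b, (a ≤ 0 → b < a - C → φ a b = 0) ∧ (0 < a → a + C < b → φ a b = 0)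

/-- The families of rows whose determinants have finite support in the winding numbers: all rows
are banded, and at least one of them is bounded above at level `0` as well. -/
def RingBanded {P : ℕ} (Φ : Fin P → ℤ → ℤ → ℝ) : Prop :=
  (∀ i, RowBanded (Φ i)) ∧ (P ≠ 0 → ∃ i, ∃ C : ℤ, ∀ b, C < b → Φ i 0 b = 0)

lemma sum_sub_le_of_le {P : ℕ} {n : Fin P → ℤ} {M : ℤ} (hM : ∀ i, n i ≤ M) (k : Fin P) :
    M - n k ≤ P * M - ∑ i, n i := by
  have : (P : ℤ) * M - ∑ i, n i = ∑ i, (M - n i) := by simp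
  rw [this]
  exact single_le_sum (f := fun i => M - n i) (fun i _ => by have := hM i; omega) (mem_univ k)

/-- The levels `a i` sum to `0`.  If the winding numbers were far apart, the largest and the
smallest would move the positions away from the diagonal at the relative rate `L - P > 0`; once
they are close together, the rows at levels of either sign bound them. -/
lemma bounded_winding {P L : ℕ} (hPL : P < L) (i₀ : Fin P) {C : ℤ} {n e h a b : Fin P → ℤ}
    (he : ∀ i, |e i| ≤ C) (hh : ∀ i, |h i| ≤ C) (hsum : ∑ i, e i = 0)
    (ha : ∀ i, a i = P * n i - ∑ k, n k + e i) (hb : ∀ i, b i = L * n i + h i)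
    (low : ∀ i, a i ≤ 0 → a i - C ≤ b i) (up : ∀ i, 0 < a i → b i ≤ a i + C)
    (up₀ : a i₀ = 0 → b i₀ ≤ C) (i : Fin P) :
    |n i| ≤ (P * (6 * C) + C) + 2 * C + 6 * C := by
  have hC : 0 ≤ C := (abs_nonneg _).trans (he i₀)
  have e1 : ∀ i, -C ≤ e i ∧ e i ≤ C := fun i => abs_le.mp (he i)
  have h1 : ∀ i, -C ≤ h i ∧ h i ≤ C := fun i => abs_le.mp (hh i)
  obtain ⟨p, -, hp⟩ := exists_max_image univ n ⟨i₀, mem_univ _⟩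
  obtain ⟨m, -, hm⟩ := exists_min_image univ n ⟨i₀, mem_univ _⟩
  have hp' : ∀ i, n i ≤ n p := fun i => hp i (mem_univ i)
  have hm' : ∀ i, n m ≤ n i := fun i => hm i (mem_univ i)
  have spreadUp : ∀ k, n p - n k ≤ P * n p - ∑ i, n i := sum_sub_le_of_le hp'
  have spreadLow : ∀ k, n k - n m ≤ ∑ i, n i - P * n m := fun k => by
    have := sum_sub_le_of_le (n := fun i => - n i) (M := - n m) (fun i => by
      have := hm' i; omega) k
    rw [sum_neg_distrib] at this
    linarith
  have hD : (1 : ℤ) ≤ (L : ℤ) - P := by omega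
  have hL : (1 : ℤ) ≤ L := by omega
  have spread : n p - n m ≤ 6 * C := by
    rcases le_or_gt (a p) 0 with h0 | h0
    · have := spreadUp m
      have := ha p
      have := e1 p
      linarith
    rcases lt_or_ge 0 (a m) with h2 | h2
    · have := spreadLow p
      have := ha m
      have := e1 m
      linarith
    have u1 := up p h0
    have u2 := low m h2
    have := e1 p
    have := e1 m
    have := h1 p
    have := h1 m
    rw [ha, hb] at u1 u2
    have k1 : (L - P : ℤ) * (n p - n m) ≤ 6 * C := by linarith
    nlinarith [hm' p]
  have bound : ∀ i, |a i| ≤ P * (6 * C) + C := by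
    intro i
    have s1 : ∑ k, n k ≤ P * (n i + 6 * C) := by
      have := sum_le_card_nsmul univ n (n i + 6 * C) fun k _ => by
        have := hp' k; have := hm' i; omega
      simpa using this
    have s2 : P * (n i - 6 * C) ≤ ∑ k, n k := by
      have := card_nsmul_le_sum univ n (n i - 6 * C) fun k _ => by
        have := hp' i; have := hm' k; omega
      simpa using this
    have := e1 i
    rw [ha, abs_le]
    constructor <;> linarith
  have hsa : ∑ i, a i = 0 := by
    simp only [ha, sum_add_distrib, sum_sub_distrib, hsum, ← mul_sum]
    simp
  have hi1 := hp' i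
  have hi2 := hm' i
  have upper : ∃ k, n k ≤ (P * (6 * C) + C) + 2 * C := by
    obtain ⟨k, hk⟩ : ∃ k, b k ≤ P * (6 * C) + C + C := by
      by_cases hpos : ∃ k, 0 < a k
      · obtain ⟨k, hk⟩ := hpos
        have := up k hk
        have := (abs_le.mp (bound k)).2
        exact ⟨k, by linarith⟩
      · push Not at hpos
        have h0 := (sum_eq_zero_iff_of_nonpos fun k _ => hpos k).mp hsa i₀ (mem_univ _)
        exact ⟨i₀, by have := up₀ h0; have := (abs_nonneg _).trans (bound i₀); linarith⟩
    refine ⟨k, ?_⟩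
    rw [hb] at hk
    have := h1 k
    have := (abs_nonneg _).trans (bound i₀)
    by_contra hc
    nlinarith
  have lower : ∃ k, -((P * (6 * C) + C) + 2 * C) ≤ n k := by
    obtain ⟨k, -, hk⟩ := exists_le_of_sum_le (f := a) (g := fun _ => (0 : ℤ)) (s := univ)
      ⟨i₀, mem_univ _⟩ (by simp [hsa])
    refine ⟨k, ?_⟩
    have h2 := low k hk
    rw [hb] at h2
    have := h1 k
    have := (abs_le.mp (bound k)).1
    have := (abs_nonneg _).trans (bound i₀)
    by_contra hc
    nlinarith
  obtain ⟨k, hk⟩ := upper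
  obtain ⟨l, hl⟩ := lower
  have := hm' k
  have := hp' l
  rw [abs_le]
  constructor <;> linarith

lemma finite_winding_of_perm {P L : ℕ} (hPL : P < L) {Φ : Fin P → ℤ → ℤ → ℝ} (hΦ : RingBanded Φ)
    (Y : Fin P → ℤ) (σ : Equiv.Perm (Fin P)) :
    {n : Fin P → ℤ | ∀ i, ringMatrix L Φ Y n i (σ i) ≠ 0}.Finite := by
  rcases Nat.eq_zero_or_pos P with rfl | hP
  · exact Set.toFinite _
  obtain ⟨hrow, hstrong⟩ := hΦ
  obtain ⟨i₀, C₀, h₀⟩ := hstrong hP.ne'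
  choose c hc using hrow
  have hY : ∀ j, |Y j| ≤ ∑ k, |Y k| := fun j =>
    single_le_sum (f := fun k => |Y k|) (fun _ _ => abs_nonneg _) (mem_univ j)
  have hcs : ∀ j, |c j| ≤ ∑ k, |c k| := fun j =>
    single_le_sum (f := fun k => |c k|) (fun _ _ => abs_nonneg _) (mem_univ j)
  set C : ℤ := P + ∑ k, |Y k| + ∑ k, |c k| + |C₀| with hCdef
  have n1 : 0 ≤ ∑ k, |Y k| := sum_nonneg fun _ _ => abs_nonneg _
  have n2 : 0 ≤ ∑ k, |c k| := sum_nonneg fun _ _ => abs_nonneg _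
  have n3 : 0 ≤ |C₀| := abs_nonneg _
  have n4 := le_abs_self C₀
  refine (Set.finite_Icc (fun _ => -((P * (6 * C) + C) + 2 * C + 6 * C))
    (fun _ => (P * (6 * C) + C) + 2 * C + 6 * C)).subset fun n hn => ?_
  simp only [ringMatrix, Matrix.of_apply, Set.mem_ofPred_eq] at hn
  have main := bounded_winding hPL i₀ (C := C) (n := n)
    (e := fun i => (i : ℤ) - (σ i : ℕ)) (h := fun i => - Y (σ i))
    (a := fun i => (i : ℤ) - (σ i : ℕ) + P * n i - ∑ k, n k)
    (b := fun i => n i * L - Y (σ i))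
    (fun i => by
      have := i.isLt
      have := (σ i).isLt
      rw [abs_le]
      constructor <;> omega)
    (fun i => by
      have := hY (σ i)
      rw [abs_neg]
      linarith)
    (by
      rw [sum_sub_distrib, Equiv.sum_comp σ (fun i : Fin P => ((i : ℕ) : ℤ)), sub_self])
    (fun i => by ring) (fun i => by ring)
    (fun i hi => by
      by_contra hlt
      refine hn i ((hc i _ _).1 hi ?_)
      have := hcs i
      have := le_abs_self (c i)
      linarith)
    (fun i hi => by
      by_contra hlt
      refine hn i ((hc i _ _).2 hi ?_)
      have := hcs i
      have := le_abs_self (c i)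
      linarith)
    (fun hi => by
      by_contra hlt
      refine hn i₀ ?_
      rw [hi]
      exact h₀ _ (by linarith))
  exact ⟨fun i => (abs_le.mp (main i)).1, fun i => (abs_le.mp (main i)).2⟩

lemma ringSummand_eq_sum_perm {P : ℕ} (L : ℕ) (Φ : Fin P → ℤ → ℤ → ℝ) (Y n : Fin P → ℤ) :
    ringSummand L Φ Y n = ∑ σ : Equiv.Perm (Fin P), (-1 : ℝ) ^ (((P : ℤ) - 1) * ∑ i, n i) *
      ((Equiv.Perm.sign σ : ℤ) * ∏ i, ringMatrix L Φ Y n i (σ i)) := by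
  rw [ringSummand, ← Matrix.det_transpose, Matrix.det_apply', mul_sum]
  rfl

lemma finite_support_ringSummand {P L : ℕ} (hPL : P < L) {Φ : Fin P → ℤ → ℤ → ℝ}
    (hΦ : RingBanded Φ) (Y : Fin P → ℤ) : {n | ringSummand L Φ Y n ≠ 0}.Finite := by
  refine (Set.finite_iUnion (finite_winding_of_perm hPL hΦ Y)).subset fun n hn => ?_
  rw [Set.mem_ofPred_eq, ringSummand_eq_sum_perm] at hn
  obtain ⟨σ, -, hσ⟩ := exists_ne_zero_of_sum_ne_zero hn
  refine Set.mem_iUnion.mpr ⟨σ, fun i hi => hσ ?_⟩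
  rw [prod_eq_zero (mem_univ i) hi, mul_zero, mul_zero]

lemma summable_ringSummand {P L : ℕ} (hPL : P < L) {Φ : Fin P → ℤ → ℤ → ℝ} (hΦ : RingBanded Φ)
    (Y : Fin P → ℤ) : Summable (ringSummand L Φ Y) :=
  summable_of_hasFiniteSupport (finite_support_ringSummand hPL hΦ Y)

/-- The sum over winding numbers is linear in each row. -/
lemma ringSum_row_add {P L : ℕ} (hPL : P < L) {Φ Φ₁ Φ₂ : Fin P → ℤ → ℤ → ℝ} (k : Fin P)
    {α β : ℝ} (h1 : ∀ i ≠ k, Φ₁ i = Φ i) (h2 : ∀ i ≠ k, Φ₂ i = Φ i)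
    (hk : ∀ a b, Φ k a b = α * Φ₁ k a b + β * Φ₂ k a b) (hb1 : RingBanded Φ₁)
    (hb2 : RingBanded Φ₂) (Y : Fin P → ℤ) :
    ringSum L Φ Y = α * ringSum L Φ₁ Y + β * ringSum L Φ₂ Y := by
  have s1 := summable_ringSummand hPL hb1 Y
  have s2 := summable_ringSummand hPL hb2 Y
  rw [ringSum, ringSum, ringSum, ← tsum_mul_left, ← tsum_mul_left,
    ← (s1.mul_left α).tsum_add (s2.mul_left β)]
  refine tsum_congr fun n => ?_
  have e : ∀ Ψ : Fin P → ℤ → ℤ → ℝ, (∀ i ≠ k, Ψ i = Φ i) → ringMatrix L Ψ Y n =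
      (ringMatrix L Φ Y n).updateRow k (ringMatrix L Ψ Y n k) := by
    intro Ψ hΨ
    ext i j
    by_cases hi : i = k
    · subst hi; simp
    · rw [Matrix.updateRow_ne hi]
      simp [ringMatrix, hΨ i hi]
  have e0 : ringMatrix L Φ Y n k = α • ringMatrix L Φ₁ Y n k + β • ringMatrix L Φ₂ Y n k := by
    ext j
    simp [ringMatrix, hk]
  have key : (ringMatrix L Φ Y n).det =
      α * (ringMatrix L Φ₁ Y n).det + β * (ringMatrix L Φ₂ Y n).det := by
    rw [e Φ fun _ _ => rfl, e0, Matrix.det_updateRow_add, Matrix.det_updateRow_smul,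
      Matrix.det_updateRow_smul, ← e Φ₁ h1, ← e Φ₂ h2]
  rw [ringSummand, ringSummand, ringSummand, key]
  ring

/-- Exchanging the winding numbers of two particles that are neighbours on the ring, the
particle `k` being `c` turns ahead in its labelling. -/
def swapWinding {P : ℕ} (i k : Fin P) (hik : i ≠ k) (c : ℤ) : Equiv.Perm (Fin P → ℤ) :=
  Function.Involutive.toPerm
    (fun n l => if l = k then n i + c else if l = i then n k - c else n l) (by
      intro n
      funext l
      by_cases hk : l = k
      · subst hk
        simp [hik]
      · by_cases hi : l = i
        · subst hi
          simp [hik]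
        · simp [hk, hi])

lemma swapWinding_apply {P : ℕ} (i k : Fin P) (hik : i ≠ k) (c : ℤ) (n : Fin P → ℤ)
    (l : Fin P) : swapWinding i k hik c n l =
      if l = k then n i + c else if l = i then n k - c else n l := rfl

lemma sum_swapWinding {P : ℕ} (i k : Fin P) (hik : i ≠ k) (c : ℤ) (n : Fin P → ℤ) :
    ∑ l, swapWinding i k hik c n l = ∑ l, n l := by
  rw [← sub_eq_zero, ← sum_sub_distrib, ← sum_subset (subset_univ {i, k}), sum_pair hik]
  · simp only [swapWinding_apply, if_neg hik, if_true]
    ring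
  · intro l _ hl
    simp only [mem_insert, mem_singleton, not_or] at hl
    simp [swapWinding_apply, hl.1, hl.2]

/-- If the row of `k` is a multiple of the row of `i`, where `k` comes next after `i` in the
cyclic order, then exchanging their winding numbers changes the sign of the determinant. -/
lemma ringSum_eq_zero_of_neighbours {P L : ℕ} {Φ : Fin P → ℤ → ℤ → ℝ} {i k : Fin P} (hik : i ≠ k)
    {c : ℤ} (hk : (k : ℤ) + c * P = i + 1) {κ : ℝ}
    (h : ∀ a b, Φ k (a + 1) (b + c * L) = κ * Φ i a b) (Y : Fin P → ℤ) :
    ringSum L Φ Y = 0 := by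
  have hk' : ∀ a b, Φ k a b = κ * Φ i (a - 1) (b - c * L) := fun a b => by
    rw [← h, sub_add_cancel, sub_add_cancel]
  -- the matrix with the factor `κ` taken out of row `k`
  let M : (Fin P → ℤ) → Matrix (Fin P) (Fin P) ℝ := fun n => Matrix.of fun l j =>
    if l = k then Φ i ((i : ℤ) - (j : ℤ) + P * (n k - c) - ∑ m, n m) ((n k - c) * L - Y j)
    else ringMatrix L Φ Y n l j
  have hM : ∀ n, (ringMatrix L Φ Y n).det = κ * (M n).det := by
    intro n
    have : ringMatrix L Φ Y n = Matrix.of fun l j => (if l = k then κ else 1) * M n l j := by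
      ext l j
      by_cases hl : l = k
      · subst hl
        simp only [ringMatrix, Matrix.of_apply, M, if_true]
        rw [hk']
        congr 2
        · linear_combination hk
        · ring
      · simp [M, hl]
    rw [this, Matrix.det_mul_column, prod_ite_eq' univ k]
    simp
  have hswap : ∀ n, M (swapWinding i k hik c n) = (M n).submatrix (Equiv.swap i k) id := by
    intro n
    ext l j
    by_cases hl : l = k
    · subst hl
      simp only [M, Matrix.of_apply, Matrix.submatrix_apply, if_true, Equiv.swap_apply_right,
        if_neg hik, ringMatrix, sum_swapWinding, id_eq]
      simp only [swapWinding_apply, if_true, add_sub_cancel_right]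
    · by_cases hi : l = i
      · subst hi
        simp only [M, Matrix.of_apply, Matrix.submatrix_apply, if_true, Equiv.swap_apply_left,
          if_neg hik, ringMatrix, sum_swapWinding, id_eq]
        simp only [swapWinding_apply, if_true, if_neg hik]
      · simp only [M, Matrix.of_apply, Matrix.submatrix_apply, if_neg hl,
          Equiv.swap_apply_of_ne_of_ne hi hl, ringMatrix, sum_swapWinding, id_eq]
        simp only [swapWinding_apply, if_neg hl, if_neg hi]
  have hneg : ∀ n, ringSummand L Φ Y (swapWinding i k hik c n) = -ringSummand L Φ Y n := by
    intro n
    rw [ringSummand, ringSummand, hM, hM, hswap, Matrix.det_permute, Equiv.Perm.sign_swap hik,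
      sum_swapWinding]
    simp
  have := (swapWinding i k hik c).tsum_eq (ringSummand L Φ Y)
  simp only [hneg, tsum_neg] at this
  rw [ringSum]
  linarith

/-! ### Configurations and neighbours on the ring -/

lemma mem_ringConfigs {P L : ℕ} {X : Fin P → ℤ} :
    X ∈ ringConfigs P L ↔ (∀ i, 1 ≤ X i ∧ X i ≤ L) ∧ StrictMono X := by
  simp [ringConfigs]

/-- The particles whose previous site on the ring is vacant.  Each cluster contains exactly one
of them, its last particle. -/
def tailParticles {P : ℕ} (L : ℕ) (X : Fin P → ℤ) : Finset (Fin P) :=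
  {k | ((X k - 1 : ℤ) : ZMod L) ∉ occupiedSites L X}

lemma mem_occupiedSites {P L : ℕ} {X : Fin P → ℤ} {x : ZMod L} :
    x ∈ occupiedSites L X ↔ ∃ i, (X i : ZMod L) = x := by
  simp [occupiedSites]

lemma mem_frontParticles {P L : ℕ} {X : Fin P → ℤ} {k : Fin P} :
    k ∈ frontParticles L X ↔ ∀ i, (X i : ZMod L) ≠ X k + 1 := by
  simp [frontParticles, mem_occupiedSites]

lemma mem_tailParticles {P L : ℕ} {X : Fin P → ℤ} {k : Fin P} :
    k ∈ tailParticles L X ↔ ∀ i, (X i : ZMod L) ≠ X k - 1 := by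
  simp [tailParticles, mem_occupiedSites]

lemma eq_of_cast_eq {P L : ℕ} {X : Fin P → ℤ} (hX : X ∈ ringConfigs P L) {i k : Fin P}
    (h : (X i : ZMod L) = X k) : i = k := by
  rw [mem_ringConfigs] at hX
  obtain ⟨d, hd⟩ := (ZMod.intCast_eq_intCast_iff_dvd_sub _ _ _).mp h
  have h1 := hX.1 i
  have h2 := hX.1 k
  apply hX.2.injective
  have : d = 0 := by
    rcases lt_trichotomy d 0 with h0 | h0 | h0
    · nlinarith
    · exact h0
    · nlinarith
  rw [this] at hd
  omega

lemma strictMono_sub_le {P : ℕ} {X : Fin P → ℤ} (hX : StrictMono X) {i k : Fin P} (h : i ≤ k) :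
    (k : ℤ) - i ≤ X k - X i := by
  obtain ⟨k, hk⟩ := k
  induction k with
  | zero =>
    have : i = ⟨0, hk⟩ := le_antisymm h (Fin.mk_le_of_le_val (Nat.zero_le _))
    simp [this]
  | succ m ih =>
    rcases h.eq_or_lt with rfl | hlt
    · simp
    · have := ih (by omega) (Nat.le_of_lt_succ hlt)
      have h2 := hX (show (⟨m, by omega⟩ : Fin P) < ⟨m + 1, hk⟩ from Nat.lt_succ_self m)
      push_cast at this ⊢
      omega

/-- A particle whose previous site is occupied is the next one, in the cyclic labelling, after
the particle at that site. -/
lemma neighbour_label {P L : ℕ} (hPL : P < L) {X : Fin P → ℤ} (hX : X ∈ ringConfigs P L)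
    {i k : Fin P} (h : (X i : ZMod L) = X k - 1) :
    i ≠ k ∧ ∃ c : ℤ, (k : ℤ) + c * P = i + 1 ∧ X k + c * L = X i + 1 := by
  rw [mem_ringConfigs] at hX
  have h' : (X i : ZMod L) = (X k - 1 : ℤ) := by rw [h]; push_cast; rfl
  obtain ⟨d, hd⟩ := (ZMod.intCast_eq_intCast_iff_dvd_sub _ _ _).mp h'
  have h1 := hX.1 i
  have h2 := hX.1 k
  have hP := i.isLt
  have hd0 : -1 ≤ d ∧ d ≤ 0 := by
    constructor
    · by_contra hc
      nlinarith
    · by_contra hc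
      nlinarith
  have hcase : d = 0 ∨ d = -1 := by omega
  rcases hcase with rfl | rfl
  · have hlt : i < k := by
      by_contra hc
      have := hX.2.monotone (not_lt.mp hc)
      omega
    have := strictMono_sub_le hX.2 hlt.le
    have h3 : (i : ℕ) < k := hlt
    exact ⟨hlt.ne, 0, by omega, by omega⟩
  · have i0 := strictMono_sub_le hX.2 (i := ⟨0, by omega⟩) (k := k) (Nat.zero_le _)
    have i1 := strictMono_sub_le hX.2 (i := i) (k := ⟨P - 1, by omega⟩) (by
      rw [Fin.le_def]; simp only; omega)
    have h3 := (hX.1 ⟨0, by omega⟩).1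
    have h4 := (hX.1 ⟨P - 1, by omega⟩).2
    have : i ≠ k := by
      rintro rfl
      omega
    refine ⟨this, 1, ?_, by omega⟩
    push_cast at i0 i1
    omega

lemma le_card_of_add_one_mem {L : ℕ} (hL : 0 < L) {s : Finset (ZMod L)} (hs : s.Nonempty)
    (h : ∀ x ∈ s, x + 1 ∈ s) : L ≤ s.card := by
  have : NeZero L := ⟨hL.ne'⟩
  obtain ⟨x, hx⟩ := hs
  have key : ∀ m : ℕ, x + m ∈ s := by
    intro m
    induction m with
    | zero => simpa using hx
    | succ m ih => rw [Nat.cast_succ, ← add_assoc]; exact h _ ih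
  have : s = univ := eq_univ_of_forall fun y => by
    have := key (y - x).val
    rwa [ZMod.natCast_zmod_val, add_sub_cancel] at this
  rw [this, card_univ, ZMod.card]

lemma numClusters_eq_card_tailParticles {P L : ℕ} {X : Fin P → ℤ} (hX : X ∈ ringConfigs P L) :
    numClusters L X = (tailParticles L X).card := by
  have h : ((frontParticles L X)ᶜ).card = ((tailParticles L X)ᶜ).card := by
    have hf : ∀ k ∈ (frontParticles L X)ᶜ, ∃ i, (X i : ZMod L) = X k + 1 := by
      intro k hk
      by_contra hc
      push Not at hc
      exact (mem_compl.mp hk) (mem_frontParticles.mpr hc)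
    choose! g hg using hf
    refine card_bij (fun k _ => g k) ?_ ?_ ?_
    · intro k hk
      rw [mem_compl, mem_tailParticles]
      push Not
      exact ⟨k, by rw [hg k hk]; ring⟩
    · intro k hk l hl hkl
      apply eq_of_cast_eq hX
      have := hg k hk
      rw [hkl, hg l hl] at this
      exact (add_right_cancel this).symm
    · intro l hl
      rw [mem_compl, mem_tailParticles] at hl
      push Not at hl
      obtain ⟨k, hk⟩ := hl
      have hk' : k ∈ (frontParticles L X)ᶜ := by
        rw [mem_compl, mem_frontParticles]
        push Not
        exact ⟨l, by rw [hk]; ring⟩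
      refine ⟨k, hk', eq_of_cast_eq hX ?_⟩
      rw [hg k hk', hk]
      ring
  rw [card_compl, card_compl] at h
  have h1 := card_le_univ (frontParticles L X)
  have h2 := card_le_univ (tailParticles L X)
  rw [numClusters]
  omega

/-! ### Elimination of the rows of the particles that are not last in their cluster -/

/-- Bounds on the support of a row function that are stronger than `RowBanded`: the upper one
also holds at level `0`, so that a simultaneous shift of `a` and `b` leaves a banded row. -/
def RowStronglyBanded (φ : ℤ → ℤ → ℝ) : Prop :=
  ∃ C : ℤ, ∀ a b, (a ≤ 0 → b < a - C → φ a b = 0) ∧ (0 ≤ a → a + C < b → φ a b = 0)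

lemma RowStronglyBanded.rowBanded {φ : ℤ → ℤ → ℝ} (h : RowStronglyBanded φ) : RowBanded φ := by
  obtain ⟨C, hC⟩ := h
  exact ⟨C, fun a b => ⟨(hC a b).1, fun ha => (hC a b).2 ha.le⟩⟩

lemma RowBanded.shift {φ : ℤ → ℤ → ℝ} (h : RowBanded φ) (x : ℤ) :
    RowBanded fun a b => φ a (x + b) := by
  obtain ⟨C, hC⟩ := h
  refine ⟨C + |x|, fun a b => ⟨fun ha hb => (hC _ _).1 ha ?_, fun ha hb => (hC _ _).2 ha ?_⟩⟩
  · have := le_abs_self x; omega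
  · have := neg_abs_le x; omega

lemma RowStronglyBanded.shift_level {φ : ℤ → ℤ → ℝ} (h : RowStronglyBanded φ) :
    RowBanded fun a b => φ (a - 1) (b - 1) := by
  obtain ⟨C, hC⟩ := h
  exact ⟨C, fun a b => ⟨fun ha hb => (hC _ _).1 (by omega) (by omega),
    fun ha hb => (hC _ _).2 (by omega) (by omega)⟩⟩

lemma ringBanded_shift {P : ℕ} {φ : Fin P → ℤ → ℤ → ℝ} (X : Fin P → ℤ)
    (h : ∀ i, RowBanded (φ i)) (hs : P ≠ 0 → ∃ i, RowStronglyBanded (φ i)) :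
    RingBanded fun i a b => φ i a (X i + b) := by
  refine ⟨fun i => (h i).shift (X i), fun hP => ?_⟩
  obtain ⟨i, C, hC⟩ := hs hP
  exact ⟨i, C - X i, fun b hb => (hC 0 _).2 le_rfl (by omega)⟩

/-- The rows of a configuration `X`, given by `φ` for the particles of `U` and by `ψ` for the
others. -/
def mixedRows {P : ℕ} (φ ψ : ℤ → ℤ → ℝ) (U : Finset (Fin P)) (X : Fin P → ℤ) :
    Fin P → ℤ → ℤ → ℝ :=
  fun i a b => (if i ∈ U then φ else ψ) a (X i + b)

/-- The cancellation between neighbours allows to replace `φ` by `ψ` in the row of a particle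
whose predecessor in the cluster still has the row `φ`. -/
lemma ringSum_mixedRows_erase {P L : ℕ} (hPL : P < L) {φ ψ : ℤ → ℤ → ℝ} {κ : ℝ}
    (hrel : ∀ a b, φ a b = ψ a b + κ * φ (a - 1) (b - 1)) (hφ : RowStronglyBanded φ)
    (hψ : RowBanded ψ) {X : Fin P → ℤ} (hX : X ∈ ringConfigs P L) {U : Finset (Fin P)}
    {i k : Fin P} (hi : i ∈ U) (hk : k ∈ U) (hik : (X i : ZMod L) = X k - 1) (Y : Fin P → ℤ) :
    ringSum L (mixedRows φ ψ U X) Y = ringSum L (mixedRows φ ψ (U.erase k) X) Y := by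
  obtain ⟨hne, c, hc1, hc2⟩ := neighbour_label hPL hX hik
  let χ : Fin P → ℤ → ℤ → ℝ := fun l a b =>
    if l = k then φ (a - 1) (b - 1) else (if l ∈ U then φ else ψ) a b
  have b1 : RingBanded (mixedRows φ ψ (U.erase k) X) := by
    refine ringBanded_shift (φ := fun l => if l ∈ U.erase k then φ else ψ) X (fun l => ?_)
      fun _ => ⟨i, ?_⟩
    · split_ifs
      exacts [hφ.rowBanded, hψ]
    · rwa [if_pos (mem_erase.mpr ⟨hne, hi⟩)]
  have b2 : RingBanded fun l a b => χ l a (X l + b) := by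
    refine ringBanded_shift X (fun l => ?_) fun _ => ⟨i, ?_⟩
    · by_cases hl : l = k
      · simpa only [χ, if_pos hl] using hφ.shift_level
      · simp only [χ, if_neg hl]
        split_ifs
        exacts [hφ.rowBanded, hψ]
    · simpa only [χ, if_neg hne, if_pos hi] using hφ
  rw [ringSum_row_add hPL (Φ₁ := mixedRows φ ψ (U.erase k) X) (Φ₂ := fun l a b => χ l a (X l + b))
    k (α := 1) (β := κ) _ _ _ b1 b2]
  · rw [ringSum_eq_zero_of_neighbours (Φ := fun l a b => χ l a (X l + b)) hne hc1 (κ := 1)]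
    · ring
    · intro a b
      simp only [χ, if_true, if_neg hne, if_pos hi, one_mul]
      rw [add_sub_cancel_right]
      congr 1
      linear_combination hc2
  · intro l hl
    funext a b
    simp [mixedRows, hl]
  · intro l hl
    funext a b
    simp [mixedRows, χ, hl]
  · intro a b
    simp only [mixedRows, χ, if_pos hk, mem_erase, ne_eq, not_true_eq_false, false_and, if_false,
      if_true]
    rw [hrel, one_mul]

/-- Starting from the front of each cluster, `φ` is replaced by `ψ` in the rows of all particles
but the last one of each cluster.  This is possible because the ring has a vacant site. -/
lemma ringSum_mixedRows_univ {P L : ℕ} (hPL : P < L) {φ ψ : ℤ → ℤ → ℝ} {κ : ℝ}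
    (hrel : ∀ a b, φ a b = ψ a b + κ * φ (a - 1) (b - 1)) (hφ : RowStronglyBanded φ)
    (hψ : RowBanded ψ) {X : Fin P → ℤ} (hX : X ∈ ringConfigs P L) (Y : Fin P → ℤ) :
    ringSum L (mixedRows φ ψ univ X) Y = ringSum L (mixedRows φ ψ (tailParticles L X) X) Y := by
  suffices H : ∀ U : Finset (Fin P), tailParticles L X ⊆ U →
      (∀ k ∈ U, ∀ i, (X i : ZMod L) = X k - 1 → i ∈ U) →
      ringSum L (mixedRows φ ψ U X) Y = ringSum L (mixedRows φ ψ (tailParticles L X) X) Y from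
    H univ (subset_univ _) fun _ _ _ _ => mem_univ _
  intro U
  induction U using Finset.strongInduction with
  | H U ih =>
    intro hU hcl
    by_cases hne : (U \ tailParticles L X).Nonempty
    · -- otherwise the particles of `U` that are not last in their cluster would fill the ring
      obtain ⟨k, hk, hkmax⟩ : ∃ k ∈ U \ tailParticles L X, ∀ l ∈ U, (X l : ZMod L) ≠ X k + 1 := by
        by_contra hc
        push Not at hc
        have h1 : L ≤ ((U \ tailParticles L X).image fun k => (X k : ZMod L)).card := by
          refine le_card_of_add_one_mem (by omega) (hne.image _) fun x hx => ?_
          obtain ⟨k, hk, rfl⟩ := mem_image.mp hx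
          obtain ⟨l, hl, hlk⟩ := hc k hk
          refine mem_image.mpr ⟨l, mem_sdiff.mpr ⟨hl, fun ht => ?_⟩, hlk⟩
          exact mem_tailParticles.mp ht k (by rw [hlk]; ring)
        have h2 := card_image_le (s := U \ tailParticles L X) (f := fun k => (X k : ZMod L))
        have h3 := card_le_univ (U \ tailParticles L X)
        rw [Fintype.card_fin] at h3
        omega
      rw [mem_sdiff] at hk
      obtain ⟨i, hi⟩ : ∃ i, (X i : ZMod L) = X k - 1 := by
        by_contra hc
        push Not at hc
        exact hk.2 (mem_tailParticles.mpr hc)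
      rw [ringSum_mixedRows_erase hPL hrel hφ hψ hX (hcl k hk.1 i hi) hk.1 hi]
      refine ih _ (erase_ssubset hk.1) (fun l hl => mem_erase.mpr ⟨?_, hU hl⟩) ?_
      · rintro rfl
        exact hk.2 hl
      · intro l hl m hm
        refine mem_erase.mpr ⟨?_, hcl l (mem_of_mem_erase hl) m hm⟩
        rintro rfl
        exact hkmax l (mem_of_mem_erase hl) (by rw [hm]; ring)
    · rw [not_nonempty_iff_eq_empty, sdiff_eq_empty_iff_subset] at hne
      rw [subset_antisymm hne hU]

/-! ### The evolution of the determinants in time -/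

/-- The function `f` with a weight `q` for each unit of distance. -/
noncomputable def weightedF (v q : ℝ) (t : ℕ) (a b : ℤ) : ℝ := q ^ b * tasepF v a b t

/-- The sum over winding numbers of the determinants of `f`, with a weight `q` for each unit of
the total distance from `Y` to `X`. -/
noncomputable def weightedRingF {P : ℕ} (L : ℕ) (v q : ℝ) (X Y : Fin P → ℤ) (t : ℕ) : ℝ :=
  ringSum L (fun i a b => weightedF v q t a (X i + b)) Y

/-- The total weight of the displacements factors over rows and columns. -/
lemma ringSummand_weightedF {P : ℕ} (L : ℕ) (v : ℝ) {q : ℝ} (hq : q ≠ 0) (X Y : Fin P → ℤ) (t : ℕ)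
    (n : Fin P → ℤ) :
    ringSummand L (fun i a b => weightedF v q t a (X i + b)) Y n =
      q ^ (∑ j, (X j - Y j + L * n j)) * ringTerm L v X Y t n := by
  have h : ringMatrix L (fun i a b => weightedF v q t a (X i + b)) Y n =
      Matrix.of fun i j => q ^ (X i + n i * L) * Matrix.of (fun i j => q ^ (-Y j) *
        Matrix.of (fun i j : Fin P => tasepF v ((i : ℤ) - (j : ℤ) + P * n i - ∑ k, n k)
          (X i - Y j + n i * L) t) i j) i j := by
    ext i j
    simp only [ringMatrix, Matrix.of_apply, weightedF]
    rw [← mul_assoc, ← zpow_add₀ hq, show X i + (n i * L - Y j) = X i + n i * L + -Y j by ring,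
      show X i - Y j + n i * L = X i + n i * L + -Y j by ring]
  have hprod : ∀ s : Finset (Fin P), q ^ (∑ j ∈ s, (X j - Y j + L * n j)) =
      (∏ i ∈ s, q ^ (X i + n i * L)) * ∏ j ∈ s, q ^ (-Y j) := by
    intro s
    induction s using Finset.induction_on with
    | empty => simp
    | insert k s hk ih =>
      rw [sum_insert hk, prod_insert hk, prod_insert hk, zpow_add₀ hq, ih,
        show X k - Y k + L * n k = X k + n k * L + -Y k by ring, zpow_add₀ hq]
      ring
  rw [ringSummand, h, Matrix.det_mul_column, Matrix.det_mul_row, ringTerm, hprod]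
  ring

lemma weightedRingF_exp {P : ℕ} (L : ℕ) (v γ : ℝ) (X Y : Fin P → ℤ) (t : ℕ) :
    weightedRingF L v (Real.exp γ) X Y t = ringGenF L v γ X Y t := by
  refine tsum_congr fun n => ?_
  rw [ringSummand_weightedF L v (Real.exp_ne_zero γ), Real.exp_mul, Real.rpow_intCast]

lemma weightedRingF_one {P : ℕ} (L : ℕ) (v : ℝ) (X Y : Fin P → ℤ) (t : ℕ) :
    weightedRingF L v 1 X Y t = ringF L v X Y t := by
  refine tsum_congr fun n => ?_
  rw [ringSummand_weightedF L v one_ne_zero, one_zpow, one_mul]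

lemma weightedF_stronglyBanded (v q : ℝ) (t : ℕ) : RowStronglyBanded (weightedF v q t) := by
  refine ⟨t, fun a b => ⟨fun ha hb => ?_, fun ha hb => ?_⟩⟩
  · rw [weightedF, tasepF_eq_zero_of_lt v t ha (by omega), mul_zero]
  · rw [weightedF, tasepF_eq_zero_of_gt v (by omega) (by omega), mul_zero]

lemma weightedF_succ_eq_add {v q : ℝ} (hv : v < 1) (hq : q ≠ 0) (t : ℕ) (a b : ℤ) :
    weightedF v q (t + 1) a b =
      weightedF v q t a b + v / (1 - v) * q * weightedF v q (t + 1) (a - 1) (b - 1) := by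
  rw [weightedF, weightedF, weightedF, tasepF_succ_eq_add hv, zpow_sub_one₀ hq]
  field_simp

lemma weightedF_succ {v q : ℝ} (hv : v < 1) (hq : q ≠ 0) (t : ℕ) (a b : ℤ) :
    weightedF v q (t + 1) a b =
      (1 - v) * weightedF v q t a b + v * q * weightedF v q t a (b - 1) := by
  rw [weightedF, weightedF, weightedF, tasepF_succ hv, zpow_sub_one₀ hq]
  field_simp

/-- The configuration from which the particles of `S` have arrived at `X`. -/
def moveBack {P : ℕ} (X : Fin P → ℤ) (S : Finset (Fin P)) : Fin P → ℤ :=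
  fun i => X i - if i ∈ S then 1 else 0

/-- The rows of the particles of `U` make one step of free motion. -/
lemma ringSum_mixedRows_weightedF {P L : ℕ} (hPL : P < L) {v q : ℝ} (hv : v < 1) (hq : q ≠ 0)
    (t : ℕ) (Y : Fin P → ℤ) (U : Finset (Fin P)) (X : Fin P → ℤ) :
    ringSum L (mixedRows (weightedF v q (t + 1)) (weightedF v q t) U X) Y =
      ∑ S ∈ U.powerset, (1 - v) ^ (U \ S).card * (v * q) ^ S.card *
        weightedRingF L v q (moveBack X S) Y t := by
  have hband : ∀ (U : Finset (Fin P)) (X : Fin P → ℤ),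
      RingBanded (mixedRows (weightedF v q (t + 1)) (weightedF v q t) U X) := fun U X =>
    ringBanded_shift (φ := fun l => if l ∈ U then weightedF v q (t + 1) else weightedF v q t) X
      (fun l => by
        split_ifs
        exacts [(weightedF_stronglyBanded v q _).rowBanded,
          (weightedF_stronglyBanded v q _).rowBanded])
      fun hP => ⟨⟨0, Nat.pos_of_ne_zero hP⟩, by
        split_ifs
        exacts [weightedF_stronglyBanded v q _, weightedF_stronglyBanded v q _]⟩
  induction U using Finset.induction_on generalizing X with
  | empty =>
    simp only [powerset_empty, sum_singleton, sdiff_empty, card_empty, pow_zero, one_mul]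
    rw [weightedRingF]
    congr 1
    funext i a b
    simp [mixedRows, moveBack]
  | insert k U hk ih =>
    rw [ringSum_row_add hPL (Φ₁ := mixedRows (weightedF v q (t + 1)) (weightedF v q t) U X)
      (Φ₂ := mixedRows (weightedF v q (t + 1)) (weightedF v q t) U (moveBack X {k}))
      k (α := 1 - v) (β := v * q) _ _ _ (hband _ _) (hband _ _), ih, ih, sum_powerset_insert hk,
      mul_sum, mul_sum]
    · congr 1
      · refine sum_congr rfl fun S hS => ?_
        have hkS : k ∉ S := fun h => hk (mem_powerset.mp hS h)
        rw [insert_sdiff_of_notMem _ hkS, card_insert_of_notMem (by simp [hk])]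
        ring
      · refine sum_congr rfl fun S hS => ?_
        have hkS : k ∉ S := fun h => hk (mem_powerset.mp hS h)
        have e1 : insert k U \ insert k S = U \ S := by
          rw [insert_sdiff_insert, sdiff_insert_of_notMem hk]
        have e2 : moveBack (moveBack X {k}) S = moveBack X (insert k S) := by
          funext i
          by_cases hi : i = k
          · subst hi; simp [moveBack, hkS]
          · simp [moveBack, hi]
        rw [e1, card_insert_of_notMem hkS, e2]
        ring
    · intro l hl
      funext a b
      simp [mixedRows, hl]
    · intro l hl
      funext a b
      simp [mixedRows, moveBack, hl]
    · intro a b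
      simp only [mixedRows, moveBack, mem_insert_self, if_true, if_neg hk, mem_singleton]
      rw [weightedF_succ hv hq, show X k - 1 + b = X k + b - 1 by ring]

lemma mixedRows_univ {P : ℕ} (φ ψ : ℤ → ℤ → ℝ) (X : Fin P → ℤ) :
    mixedRows φ ψ univ X = fun i a b => φ a (X i + b) := by
  funext i a b
  simp [mixedRows]

/-- Because of the exclusion rule, only the last particle of each cluster of `X` may have moved
in the last step. -/
lemma weightedRingF_succ {P L : ℕ} (hPL : P < L) {v q : ℝ} (hv : v < 1) (hq : q ≠ 0)
    {X : Fin P → ℤ} (hX : X ∈ ringConfigs P L) (Y : Fin P → ℤ) (t : ℕ) :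
    weightedRingF L v q X Y (t + 1) = ∑ S ∈ (tailParticles L X).powerset,
      (1 - v) ^ (tailParticles L X \ S).card * (v * q) ^ S.card *
        weightedRingF L v q (moveBack X S) Y t := by
  rw [← ringSum_mixedRows_weightedF hPL hv hq, ← ringSum_mixedRows_univ hPL
    (fun a b => weightedF_succ_eq_add hv hq t a b) (weightedF_stronglyBanded v q _)
    (weightedF_stronglyBanded v q _).rowBanded hX, mixedRows_univ, weightedRingF]

/-! ### Cyclic relabelling and the predecessors of a configuration -/

/-- The cyclic relabelling of the particles, the first one becoming the last one after a turn
around the ring. -/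
def relabel {p : ℕ} (L : ℕ) (X : Fin (p + 1) → ℤ) : Fin (p + 1) → ℤ :=
  fun i => X (finRotate (p + 1) i) + if i = Fin.last p then (L : ℤ) else 0

/-- The effect on the winding numbers of the cyclic relabelling of the particles. -/
def relabelWinding (p : ℕ) : (Fin (p + 1) → ℤ) ≃ (Fin (p + 1) → ℤ) :=
  (Equiv.arrowCongr (finRotate (p + 1)).symm (Equiv.refl ℤ)).trans
    (Equiv.subRight (Pi.single (Fin.last p) 1))

lemma relabelWinding_apply {p : ℕ} (n : Fin (p + 1) → ℤ) (i : Fin (p + 1)) :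
    relabelWinding p n i = n (finRotate (p + 1) i) - if i = Fin.last p then 1 else 0 := by
  simp [relabelWinding, Equiv.arrowCongr_apply, Pi.single_apply]

lemma ringSum_relabel {p : ℕ} (L : ℕ) (φ : ℤ → ℤ → ℝ) (X Y : Fin (p + 1) → ℤ) :
    ringSum L (fun i a b => φ a (relabel L X i + b)) Y =
      ringSum L (fun i a b => φ a (X i + b)) Y := by
  rw [ringSum, ← (relabelWinding p).tsum_eq, ringSum]
  refine tsum_congr fun n => ?_
  have hsum : ∑ i, relabelWinding p n i = (∑ i, n i) - 1 := by
    simp only [relabelWinding_apply, sum_sub_distrib]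
    rw [Equiv.sum_comp (finRotate (p + 1)) n]
    simp
  have hmat : ringMatrix L (fun i a b => φ a (relabel L X i + b)) Y (relabelWinding p n) =
      (ringMatrix L (fun i a b => φ a (X i + b)) Y n).submatrix (finRotate (p + 1)) id := by
    ext i j
    simp only [ringMatrix, Matrix.of_apply, Matrix.submatrix_apply, hsum]
    simp only [relabelWinding_apply, relabel, id_eq]
    by_cases hi : i = Fin.last p
    · subst hi
      simp only [if_true, finRotate_last]
      congr 1
      · push_cast [Fin.val_last, Fin.val_zero]
        ring
      · ring
    · have hv : ((finRotate (p + 1) i : Fin (p + 1)) : ℕ) = i + 1 := coe_finRotate_of_ne_last hi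
      simp only [if_neg hi, hv]
      congr 1
      · push_cast
        ring
      · ring
  rw [ringSummand, ringSummand, hmat, hsum, Matrix.det_permute, sign_finRotate]
  push_cast
  rw [show ((p : ℤ) + 1 - 1) = p by ring, mul_sub, mul_one,
    zpow_sub₀ (by norm_num : (-1 : ℝ) ≠ 0), zpow_natCast]
  have : ((-1 : ℝ) ^ p) ≠ 0 := pow_ne_zero _ (by norm_num)
  field_simp

lemma mem_jumpSets {P L : ℕ} {X X' : Fin P → ℤ} {S : Finset (Fin P)} :
    S ∈ jumpSets L X X' ↔ S ⊆ frontParticles L X' ∧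
      occupiedSites L (fun i => X' i + if i ∈ S then 1 else 0) = occupiedSites L X := by
  simp [jumpSets]

lemma eq_of_occupiedSites_eq {P L : ℕ} {X Z : Fin P → ℤ} (hX : X ∈ ringConfigs P L)
    (hZ : Z ∈ ringConfigs P L) (h : occupiedSites L X = occupiedSites L Z) : X = Z := by
  have key : ∀ {X Z : Fin P → ℤ}, X ∈ ringConfigs P L → Z ∈ ringConfigs P L →
      occupiedSites L X = occupiedSites L Z → Set.range X ⊆ Set.range Z := by
    rintro X Z hX hZ h _ ⟨i, rfl⟩
    rw [mem_ringConfigs] at hX hZ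
    have hi : (X i : ZMod L) ∈ occupiedSites L Z := h ▸ mem_occupiedSites.mpr ⟨i, rfl⟩
    obtain ⟨k, hk⟩ := mem_occupiedSites.mp hi
    obtain ⟨d, hd⟩ := (ZMod.intCast_eq_intCast_iff_dvd_sub _ _ _).mp hk
    have h1 := hX.1 i
    have h2 := hZ.1 k
    have : d = 0 := by
      rcases lt_trichotomy d 0 with h0 | h0 | h0
      · nlinarith
      · exact h0
      · nlinarith
    rw [this] at hd
    exact ⟨k, by omega⟩
  exact ((mem_ringConfigs.mp hX).2.range_inj (mem_ringConfigs.mp hZ).2).mp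
    (subset_antisymm (key hX hZ h) (key hZ hX h.symm))

/-- The particles that have just jumped to `X` are last in their clusters: the site that such a
particle has left is vacant. -/
lemma subset_tailParticles_of_jump {P L : ℕ} {X X' : Fin P → ℤ} {S' : Finset (Fin P)}
    (hX' : X' ∈ ringConfigs P L) (hS' : S' ∈ jumpSets L X X') (f : Equiv.Perm (Fin P))
    (hf : ∀ k, ((X' k + if k ∈ S' then 1 else 0 : ℤ) : ZMod L) = X (f k)) :
    S'.map f.toEmbedding ⊆ tailParticles L X := by
  intro k hk
  obtain ⟨m, hm, rfl⟩ := mem_map.mp hk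
  rw [mem_jumpSets] at hS'
  rw [mem_tailParticles]
  intro i hi
  obtain ⟨l, rfl⟩ := f.surjective i
  rw [Equiv.coe_toEmbedding, ← hf, ← hf, if_pos hm] at hi
  by_cases hl : l ∈ S'
  · rw [if_pos hl] at hi
    push_cast at hi
    exact mem_frontParticles.mp (hS'.1 hl) m (by rw [hi]; ring)
  · rw [if_neg hl] at hi
    push_cast at hi
    have : l = m := eq_of_cast_eq hX' (by rw [← add_zero (X' l : ZMod L), hi]; ring)
    exact hl (this ▸ hm)

/-- Particles that are last in their clusters may have jumped to where they are in `X`. -/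
lemma mem_jumpSets_of_subset_tailParticles {P L : ℕ} {X X' : Fin P → ℤ} {S : Finset (Fin P)}
    (hX : X ∈ ringConfigs P L) (hS : S ⊆ tailParticles L X) (f : Equiv.Perm (Fin P))
    (hf : ∀ k, (X' k : ZMod L) = moveBack X S (f k)) :
    S.map f.symm.toEmbedding ∈ jumpSets L X X' := by
  rw [mem_jumpSets]
  constructor
  · intro k hk
    rw [mem_map_equiv, Equiv.symm_symm] at hk
    rw [mem_frontParticles]
    intro i hi
    rw [hf, hf, moveBack, moveBack, if_pos hk] at hi
    by_cases hi' : f i ∈ S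
    · rw [if_pos hi'] at hi
      push_cast at hi
      exact mem_tailParticles.mp (hS hi') (f k) (by rw [hi]; ring)
    · rw [if_neg hi'] at hi
      push_cast at hi
      have : f i = f k := eq_of_cast_eq hX (by rw [← sub_zero (X (f i) : ZMod L), hi]; ring)
      exact hi' (this ▸ hk)
  · have h : ∀ k, ((X' k + if k ∈ S.map f.symm.toEmbedding then 1 else 0 : ℤ) : ZMod L) =
        X (f k) := by
      intro k
      simp only [mem_map_equiv, Equiv.symm_symm]
      push_cast
      rw [hf, moveBack]
      push_cast
      ring
    ext x
    rw [mem_occupiedSites, mem_occupiedSites]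
    simp only [h]
    exact f.exists_congr_left.trans (by simp)

lemma relabel_castSucc {p L : ℕ} (X : Fin (p + 1) → ℤ) (j : Fin p) :
    relabel L X j.castSucc = X j.succ := by
  simp [relabel]

lemma relabel_last {p L : ℕ} (X : Fin (p + 1) → ℤ) :
    relabel L X (Fin.last p) = X 0 + L := by
  simp [relabel]

lemma cast_relabel {p L : ℕ} (X : Fin (p + 1) → ℤ) (i : Fin (p + 1)) :
    (relabel L X i : ZMod L) = X (finRotate (p + 1) i) := by
  rw [relabel]
  split_ifs <;> simp

lemma strictMono_moveForward {P L : ℕ} {X' : Fin P → ℤ} {S' : Finset (Fin P)}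
    (hX' : StrictMono X') (hS' : S' ⊆ frontParticles L X') :
    StrictMono fun i => X' i + if i ∈ S' then 1 else 0 := by
  intro i j hij
  have h := hX' hij
  dsimp only
  by_cases hi : i ∈ S'
  · have : X' j ≠ X' i + 1 := fun h1 =>
      mem_frontParticles.mp (hS' hi) j (by rw [h1]; push_cast; rfl)
    split_ifs <;> omega
  · rw [if_neg hi]
    split_ifs <;> omega

lemma strictMono_moveBack {P L : ℕ} {X : Fin P → ℤ} {S : Finset (Fin P)}
    (hX : StrictMono X) (hS : S ⊆ tailParticles L X) : StrictMono (moveBack X S) := by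
  intro i j hij
  have h := hX hij
  unfold moveBack
  by_cases hj : j ∈ S
  · have : X i ≠ X j - 1 := fun h1 =>
      mem_tailParticles.mp (hS hj) i (by rw [h1]; push_cast; rfl)
    split_ifs <;> omega
  · rw [if_neg hj]
    split_ifs <;> omega

lemma moveBack_moveForward {P : ℕ} (X' : Fin P → ℤ) (S : Finset (Fin P)) :
    moveBack (fun i => X' i + if i ∈ S then 1 else 0) S = X' := by
  funext i
  simp [moveBack]

lemma relabel_moveBack {p L : ℕ} (X : Fin (p + 1) → ℤ) (S' : Finset (Fin (p + 1))) :
    relabel L (moveBack X (S'.map (finRotate (p + 1)).toEmbedding)) =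
      moveBack (relabel L X) S' := by
  funext i
  simp only [relabel, moveBack, mem_map_equiv, Equiv.symm_apply_apply]
  ring

/-- When no particle crosses the bond from `L` to `1`, the configuration after the jumps is
obtained by moving the particles. -/
lemma eq_moveForward {P L : ℕ} {X X' : Fin P → ℤ} (hX : X ∈ ringConfigs P L)
    (hX' : X' ∈ ringConfigs P L) {S' : Finset (Fin P)} (hS' : S' ∈ jumpSets L X X')
    (h : ∀ i, (X' i + if i ∈ S' then 1 else 0) ≤ (L : ℤ)) :
    X = fun i => X' i + if i ∈ S' then 1 else 0 := by
  have hc := mem_ringConfigs.mp hX'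
  rw [mem_jumpSets] at hS'
  refine eq_of_occupiedSites_eq hX (mem_ringConfigs.mpr ⟨fun i => ⟨?_, h i⟩,
    strictMono_moveForward hc.2 hS'.1⟩) hS'.2.symm
  have := (hc.1 i).1
  split_ifs <;> omega

/-- When a particle crosses the bond from `L` to `1`, it becomes the first one. -/
lemma relabel_eq_moveForward {p L : ℕ} {X X' : Fin (p + 1) → ℤ} (hX : X ∈ ringConfigs (p + 1) L)
    (hX' : X' ∈ ringConfigs (p + 1) L) {S' : Finset (Fin (p + 1))} (hS' : S' ∈ jumpSets L X X')
    (hlast : X' (Fin.last p) = L) (hS : Fin.last p ∈ S') :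
    relabel L X = fun i => X' i + if i ∈ S' then 1 else 0 := by
  have hc := mem_ringConfigs.mp hX'
  rw [mem_jumpSets] at hS'
  have hmono := strictMono_moveForward hc.2 hS'.1
  set Z' : Fin (p + 1) → ℤ := fun i => X' i + if i ∈ S' then 1 else 0 with hZ'
  have hZlast : Z' (Fin.last p) = L + 1 := by simp [hZ', hS, hlast]
  have hne : ∀ i, X' i ≠ 1 := fun i h1 =>
    mem_frontParticles.mp (hS'.1 hS) i (by rw [h1, hlast]; simp)
  have h2 : ∀ i, 2 ≤ Z' i := by
    intro i
    have := hne i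
    have := (hc.1 i).1
    simp only [hZ']
    split_ifs <;> omega
  let Z : Fin (p + 1) → ℤ := Fin.cons 1 fun j => Z' j.castSucc
  have hrel : relabel L Z = Z' := by
    funext i
    refine Fin.lastCases ?_ (fun j => ?_) i
    · rw [relabel_last, hZlast]
      simp only [Z, Fin.cons_zero]
      ring
    · rw [relabel_castSucc]
      simp [Z]
  have hL : 1 ≤ (L : ℤ) := by
    have := (hc.1 (Fin.last p)).1
    omega
  have hZ : Z ∈ ringConfigs (p + 1) L := by
    rw [mem_ringConfigs]
    constructor
    · intro i
      refine Fin.cases (by simpa [Z] using hL) (fun j => ?_) i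
      have h3 := hmono (Fin.castSucc_lt_last j)
      have := h2 j.castSucc
      simp only [Z, Fin.cons_succ]
      rw [hZlast] at h3
      omega
    · intro i j hij
      induction j using Fin.cases with
      | zero => exact absurd hij (Fin.not_lt_zero i)
      | succ j =>
        induction i using Fin.cases with
        | zero =>
          have := h2 j.castSucc
          simp only [Z, Fin.cons_succ, Fin.cons_zero]
          omega
        | succ i =>
          simp only [Z, Fin.cons_succ]
          exact hmono (Fin.castSucc_lt_castSucc_iff.mpr (Fin.succ_lt_succ_iff.mp hij))
  rw [← hrel]
  congr 1
  refine eq_of_occupiedSites_eq hX hZ ?_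
  rw [← hS'.2, ← hrel]
  ext x
  rw [mem_occupiedSites, mem_occupiedSites]
  simp only [cast_relabel]
  exact (finRotate (p + 1)).exists_congr_left.trans (by simp)

/-- The last steps that lead to `X` correspond to the sets of particles of `X`, all of them last
in their clusters, that have moved. -/
lemma sum_jumpSets_succ {p L : ℕ} (hPL : p + 1 < L) {X : Fin (p + 1) → ℤ}
    (hX : X ∈ ringConfigs (p + 1) L) (g : (Fin (p + 1) → ℤ) → ℕ → ℝ)
    (hg : ∀ Z m, g (relabel L Z) m = g Z m) :
    ∑ X' ∈ ringConfigs (p + 1) L, ∑ S' ∈ jumpSets L X X', g X' S'.card =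
      ∑ S ∈ (tailParticles L X).powerset, g (moveBack X S) S.card := by
  have hc := mem_ringConfigs.mp hX
  rw [sum_sigma']
  -- whether a particle crosses the bond from `L` to `1`
  let W : (_ : Fin (p + 1) → ℤ) × Finset (Fin (p + 1)) → Prop := fun x =>
    x.1 (Fin.last p) = L ∧ Fin.last p ∈ x.2
  classical
  have noWrap : ∀ x ∈ (ringConfigs (p + 1) L).sigma fun X' => jumpSets L X X', ¬W x →
      X = fun i => x.1 i + if i ∈ x.2 then 1 else 0 := by
    rintro ⟨X', S'⟩ hx hW
    rw [mem_sigma] at hx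
    have hc' := mem_ringConfigs.mp hx.1
    refine eq_moveForward hX hx.1 hx.2 fun i => ?_
    dsimp only at hc' ⊢
    rcases eq_or_ne i (Fin.last p) with rfl | hi
    · have h1 := (hc'.1 (Fin.last p)).2
      by_cases hS : Fin.last p ∈ S'
      · have : X' (Fin.last p) ≠ L := fun h => hW ⟨h, hS⟩
        rw [if_pos hS]
        omega
      · rw [if_neg hS]
        omega
    · have h1 := (hc'.1 (Fin.last p)).2
      have h2 := hc'.2 (Fin.lt_last_iff_ne_last.mpr hi)
      split_ifs <;> omega
  have wrap : ∀ x ∈ (ringConfigs (p + 1) L).sigma fun X' => jumpSets L X X', W x →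
      relabel L X = fun i => x.1 i + if i ∈ x.2 then 1 else 0 := by
    rintro ⟨X', S'⟩ hx hW
    rw [mem_sigma] at hx
    exact relabel_eq_moveForward hX hx.1 hx.2 hW.1 hW.2
  have noWrap' : ∀ x ∈ (ringConfigs (p + 1) L).sigma fun X' => jumpSets L X X', ¬W x →
      moveBack X x.2 = x.1 := by
    intro x hx hW
    rw [noWrap x hx hW, moveBack_moveForward]
  have wrap' : ∀ x ∈ (ringConfigs (p + 1) L).sigma fun X' => jumpSets L X X', W x →
      relabel L (moveBack X (x.2.map (finRotate (p + 1)).toEmbedding)) = x.1 := by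
    intro x hx hW
    rw [relabel_moveBack, wrap x hx hW, moveBack_moveForward]
  have mixed : ∀ x ∈ (ringConfigs (p + 1) L).sigma fun X' => jumpSets L X X', W x →
      ∀ y ∈ (ringConfigs (p + 1) L).sigma fun X' => jumpSets L X X', ¬W y →
      x.2.map (finRotate (p + 1)).toEmbedding ≠ y.2 := by
    intro x hx hW y hy hWy hxy
    have h0 : (0 : Fin (p + 1)) ∈ y.2 := by
      rw [← hxy, mem_map_equiv, ← finRotate_last, Equiv.symm_apply_apply]
      exact hW.2
    have h1 := congrFun (wrap x hx hW) (Fin.last p)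
    rw [relabel_last, hW.1, if_pos hW.2] at h1
    have h2 := congrFun (noWrap' y hy hWy) 0
    rw [moveBack, if_pos h0] at h2
    have h3 := ((mem_ringConfigs.mp (mem_sigma.mp hy).1).1 0).1
    omega
  refine sum_bij (fun x _ => if W x then x.2.map (finRotate (p + 1)).toEmbedding else x.2)
    ?_ ?_ ?_ ?_
  · intro x hx
    have hx' := mem_sigma.mp hx
    rw [mem_powerset]
    split_ifs with hW
    · refine subset_tailParticles_of_jump hx'.1 hx'.2 _ fun k => ?_
      have := congrFun (wrap x hx hW) k
      rw [← this, cast_relabel]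
    · have := subset_tailParticles_of_jump hx'.1 hx'.2 (Equiv.refl _) fun k => by
        have := congrFun (noWrap x hx hW) k
        rw [← this, Equiv.refl_apply]
      simpa using this
  · rintro x hx y hy hxy
    have ext : x.1 = y.1 → x.2 = y.2 → x = y := by
      obtain ⟨x1, x2⟩ := x
      obtain ⟨y1, y2⟩ := y
      rintro rfl rfl
      rfl
    split_ifs at hxy with h1 h2 h2
    · refine ext ?_ (map_injective _ hxy)
      rw [← wrap' x hx h1, ← wrap' y hy h2, hxy]
    · exact absurd hxy (mixed x hx h1 y hy h2)
    · exact absurd hxy.symm (mixed y hy h2 x hx h1)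
    · refine ext ?_ hxy
      rw [← noWrap' x hx h1, ← noWrap' y hy h2, hxy]
  · intro S hS
    rw [mem_powerset] at hS
    have hmono := strictMono_moveBack hc.2 hS
    by_cases hw : X 0 = 1 ∧ (0 : Fin (p + 1)) ∈ S
    · have hnotL : ∀ i, X i ≠ L := fun i h1 =>
        mem_tailParticles.mp (hS hw.2) i (by rw [h1, hw.1]; simp)
      have hm0 : moveBack X S 0 = 0 := by rw [moveBack, if_pos hw.2, hw.1, sub_self]
      have hL : ∀ i, moveBack X S i < L := fun i => by
        have := hnotL i
        have := (hc.1 i).2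
        unfold moveBack
        split_ifs <;> omega
      have hcfg : relabel L (moveBack X S) ∈ ringConfigs (p + 1) L := by
        refine mem_ringConfigs.mpr ⟨fun i => ?_, fun i j hij => ?_⟩
        · refine Fin.lastCases ?_ (fun j => ?_) i
          · rw [relabel_last, hm0]
            have := hc.1 0
            omega
          · rw [relabel_castSucc]
            have h1 := hmono (Fin.succ_pos j)
            have h2 := hL j.succ
            omega
        · induction i using Fin.lastCases with
          | last => exact absurd hij (not_lt_of_ge (Fin.le_last j))
          | cast i =>
            induction j using Fin.lastCases with
            | last =>
              have := hL i.succ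
              rw [relabel_last, hm0, relabel_castSucc]
              omega
            | cast j =>
              rw [relabel_castSucc, relabel_castSucc]
              exact hmono (Fin.succ_lt_succ_iff.mpr (Fin.castSucc_lt_castSucc_iff.mp hij))
      refine ⟨⟨relabel L (moveBack X S), S.map (finRotate (p + 1)).symm.toEmbedding⟩,
        mem_sigma.mpr ⟨hcfg,
          mem_jumpSets_of_subset_tailParticles hX hS _ fun k => cast_relabel _ k⟩, ?_⟩
      · rw [if_pos, map_map]
        · ext k
          simp
        · refine ⟨by dsimp only; rw [relabel_last, hm0, zero_add], ?_⟩
          dsimp only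
          rw [mem_map_equiv, Equiv.symm_symm, finRotate_last]
          exact hw.2
    · have hcfg : moveBack X S ∈ ringConfigs (p + 1) L := by
        refine mem_ringConfigs.mpr ⟨fun i => ?_, hmono⟩
        have h0 : 1 ≤ moveBack X S 0 := by
          have := (hc.1 0).1
          unfold moveBack
          split_ifs with h
          · have : X 0 ≠ 1 := fun h1 => hw ⟨h1, h⟩
            omega
          · omega
        have h1 := hmono.monotone (Fin.zero_le i)
        have h2 := (hc.1 i).2
        refine ⟨by omega, ?_⟩
        unfold moveBack
        split_ifs <;> omega
      refine ⟨⟨moveBack X S, S⟩, mem_sigma.mpr ⟨hcfg, ?_⟩, ?_⟩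
      · have := mem_jumpSets_of_subset_tailParticles (X' := moveBack X S) hX hS (Equiv.refl _)
          fun k => rfl
        simpa using this
      · rw [if_neg]
        rintro ⟨h1, h2⟩
        have h3 := (hc.1 (Fin.last p)).2
        dsimp only at h1 h2
        rw [moveBack, if_pos h2] at h1
        omega
  · intro x hx
    split_ifs with hW
    · rw [card_map, ← hg (moveBack _ _), wrap' x hx hW]
    · rw [noWrap' x hx hW]

/-! ### The initial condition -/

/-- Hermite's identity for integers. -/
lemma sum_fin_add_ediv {P : ℕ} (hP : 0 < P) (c : ℤ) : ∑ j : Fin P, ((j : ℤ) + c) / P = c := by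
  have hP' : (P : ℤ) ≠ 0 := by exact_mod_cast hP.ne'
  have step : ∀ c : ℤ,
      ∑ j : Fin P, ((j : ℤ) + (c + 1)) / P = ∑ j : Fin P, ((j : ℤ) + c) / P + 1 := by
    intro c
    rw [Fin.sum_univ_eq_sum_range (fun j => ((j : ℤ) + (c + 1)) / P),
      Fin.sum_univ_eq_sum_range (fun j => ((j : ℤ) + c) / P), ← sub_eq_iff_eq_add',
      ← sum_sub_distrib]
    have h := sum_range_sub (fun j : ℕ => ((j : ℤ) + c) / P) P
    rw [Int.add_comm (P : ℤ) c, Int.add_ediv_of_dvd_right (dvd_refl _), Int.ediv_self hP'] at h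
    simp only [Nat.cast_zero, zero_add, add_sub_cancel_left] at h
    refine Eq.trans (sum_congr rfl fun j _ => ?_) h
    rw [Nat.cast_succ, add_right_comm, add_assoc]
  have h0 : ∑ j : Fin P, ((j : ℤ) + 0) / P = 0 := by
    refine sum_eq_zero fun j _ => ?_
    rw [add_zero]
    exact Int.ediv_eq_zero_of_lt (by omega) (by have := j.isLt; omega)
  induction c using Int.induction_on with
  | zero => exact h0
  | succ m ih => rw [step, ih]
  | pred m ih =>
    have := step (-(m : ℤ) - 1)
    rw [sub_add_cancel, ih] at this
    linarith

/-- Two families of `P` integers with the same number of members to the right of every point,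
counted periodically, cannot all cross the point `k` in the same direction: here `(I i - k) / P`
is the signed count of the points congruent to `k` between `k` and `I i`. -/
lemma false_of_forall_cross {P : ℕ} (hP : 0 < P) {I J : Fin P → ℤ} {N k : ℤ}
    (hI : ∀ k, ∑ i, (I i - k) / P = N - k) (hJ : ∀ k, ∑ i, (J i - k) / P = N - k)
    (h : ∀ i m, k + P * m ≤ I i → k + 1 + P * m ≤ J i) : False := by
  have hP' : (0 : ℤ) < P := by exact_mod_cast hP
  have : ∑ i, (I i - k) / P ≤ ∑ i, (J i - (k + 1)) / P := by
    refine sum_le_sum fun i _ => ?_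
    have h1 := Int.mul_ediv_self_le (x := I i - k) hP'.ne'
    have h2 := h i ((I i - k) / P) (by linarith)
    rw [Int.le_ediv_iff_mul_le hP']
    linarith
  rw [hI, hJ] at this
  omega

/-- If rows at `I i` are matched with columns at `J i` in such a way that each matched pair obeys
the support conditions at time `0`, then `u = w`: a point `k` with `u k ≠ w k` would be crossed by
all pairs in the same direction. -/
lemma eq_of_matching {P : ℕ} (hP : 0 < P) {u w : ℤ → ℤ} {D : ℤ} (hD : 0 < D) (hu : Monotone u)
    (hw : Monotone w) (hu' : ∀ k m, u (k + P * m) = u k + D * m)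
    (hw' : ∀ k m, w (k + P * m) = w k + D * m) {I J : Fin P → ℤ} {N : ℤ}
    (hI : ∀ k, ∑ i, (I i - k) / P = N - k) (hJ : ∀ k, ∑ i, (J i - k) / P = N - k)
    (h1 : ∀ i, I i ≤ J i → w (J i) ≤ u (I i)) (h2 : ∀ i, J i < I i → u (I i) ≤ w (J i))
    (h3 : ∀ i, u (I i - 1) < u (I i) → I i = J i → u (I i) ≤ w (J i)) (k : ℤ) : u k = w k := by
  rcases lt_trichotomy (u k) (w k) with hlt | heq | hgt
  · exfalso
    refine false_of_forall_cross hP hJ hI (k := k) fun i m hi => ?_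
    by_contra hc
    have e1 := hu (show I i ≤ k + P * m by omega)
    have e2 := hw hi
    have e3 := h1 i (by omega)
    rw [hu'] at e1
    rw [hw'] at e2
    omega
  · exact heq
  · exfalso
    -- the leftmost point with the same value of `u`
    obtain ⟨l, hl, hmin⟩ := Int.exists_least_of_bdd (P := fun l => u l = u k)
      ⟨k - P, fun l hl => by
        by_contra hc
        have e1 := hu (show l ≤ k + P * (-1) by omega)
        rw [hu'] at e1
        omega⟩ ⟨k, rfl⟩
    have hlk := hmin k rfl
    have hstep : u (l - 1) < u l := by
      refine lt_of_le_of_ne (hu (by omega)) fun h => ?_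
      have := hmin (l - 1) (h.trans hl)
      omega
    have hwl := hw hlk
    refine false_of_forall_cross hP hI hJ (k := l) fun i m hi => ?_
    by_contra hc
    have e1 := hu hi
    have e2 := hw (show J i ≤ l + P * m by omega)
    rw [hu'] at e1
    rw [hw'] at e2
    rcases lt_or_ge (J i) (I i) with hJI | hJI
    · have := h2 i hJI
      omega
    · have hil : I i = l + P * m := by omega
      have := h3 i (by
        rw [hil, show l + P * m - 1 = (l - 1) + P * m by ring, hu', hu']
        omega) (by omega)
      omega

/-- The positions of a configuration continued quasi-periodically to all labels in `ℤ`. -/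
lemma exists_extension {P L : ℕ} (hP : 0 < P) (hPL : P < L) {X : Fin P → ℤ}
    (hX : X ∈ ringConfigs P L) :
    ∃ x : ℤ → ℤ, (∀ (i : Fin P) (n : ℤ), x (i + P * n) = X i + n * L) ∧
      (∀ k m, x (k + P * m) = x k + L * m) ∧ ∀ I J, I ≤ J → J - I ≤ x J - x I := by
  have hP' : (0 : ℤ) < P := by exact_mod_cast hP
  rw [mem_ringConfigs] at hX
  have hrep : ∀ I : ℤ, ∃ (i : Fin P) (n : ℤ), I = i + P * n := fun I => by
    have h1 := Int.emod_nonneg I hP'.ne'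
    have h2 := Int.emod_lt_of_pos I hP'
    refine ⟨⟨(I % P).toNat, by omega⟩, I / P, ?_⟩
    have := Int.emod_add_mul_ediv I P
    push_cast
    rw [Int.toNat_of_nonneg h1]
    omega
  let x : ℤ → ℤ := fun I =>
    X ⟨(I % P).toNat, by
      have h1 := Int.emod_nonneg I hP'.ne'
      have h2 := Int.emod_lt_of_pos I hP'
      omega⟩ + I / P * L
  have hx : ∀ (i : Fin P) (n : ℤ), x (i + P * n) = X i + n * L := by
    intro i n
    have h1 : ((i : ℤ) + P * n) % P = i := by
      rw [Int.add_mul_emod_self_left, Int.emod_eq_of_lt (by omega) (by have := i.isLt; omega)]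
    have h2 : ((i : ℤ) + P * n) / P = n := by
      rw [Int.add_mul_ediv_left _ _ hP'.ne',
        Int.ediv_eq_zero_of_lt (by omega) (by have := i.isLt; omega), zero_add]
    simp only [x, h1, h2, Int.toNat_natCast]
  refine ⟨x, hx, fun k m => ?_, fun I J hIJ => ?_⟩
  · obtain ⟨i, n, rfl⟩ := hrep k
    rw [show (i : ℤ) + P * n + P * m = i + P * (n + m) by ring, hx, hx]
    ring
  · obtain ⟨i, n, rfl⟩ := hrep I
    obtain ⟨j, m, rfl⟩ := hrep J
    rw [hx, hx]
    have hi := i.isLt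
    have hj := j.isLt
    rcases lt_trichotomy n m with h | rfl | h
    · have i0 := strictMono_sub_le hX.2 (i := ⟨0, by omega⟩) (k := j) (Nat.zero_le _)
      have i1 := strictMono_sub_le hX.2 (i := i) (k := ⟨P - 1, by omega⟩) (by
        rw [Fin.le_def]; simp only; omega)
      have h3 := (hX.1 ⟨0, by omega⟩).1
      have h4 := (hX.1 ⟨P - 1, by omega⟩).2
      push_cast [Nat.cast_sub (show 1 ≤ P by omega)] at i0 i1
      nlinarith [mul_nonneg (show (0 : ℤ) ≤ m - n - 1 by omega)
        (show (0 : ℤ) ≤ (L : ℤ) - P by omega)]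
    · have := strictMono_sub_le hX.2 (i := i) (k := j) (by rw [Fin.le_def]; omega)
      linarith
    · exfalso
      nlinarith

/-- A row at time `0`, with weights, from which the row of the particle just behind has been
eliminated. -/
noncomputable def weightedF₀ (v q : ℝ) (a b : ℤ) : ℝ := q ^ b * tasepF₀ v a b

lemma weightedF_zero_eq_add {v q : ℝ} (hq : q ≠ 0) (a b : ℤ) :
    weightedF v q 0 a b =
      weightedF₀ v q a b + v / (1 - v) * q * weightedF v q 0 (a - 1) (b - 1) := by
  rw [weightedF, weightedF₀, weightedF, tasepF₀, zpow_sub_one₀ hq]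
  field_simp
  ring

lemma weightedF₀_banded {v : ℝ} (hv : v < 1) (q : ℝ) : RowBanded (weightedF₀ v q) := by
  refine ⟨0, fun a b => ⟨fun ha hb => ?_, fun ha hb => ?_⟩⟩
  · rw [weightedF₀, tasepF₀_eq_zero_of_lt v ha (by omega), mul_zero]
  · rw [weightedF₀, tasepF₀_eq_zero_of_ge hv ha (by omega), mul_zero]

/-- Only the identity permutation with zero winding numbers contributes at time `0`, and only if
the two configurations agree. -/
lemma eq_of_forall_ne_zero {P L : ℕ} (hPL : P < L) {v : ℝ} (hv : v < 1) (q : ℝ)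
    {X Y : Fin P → ℤ} (hX : X ∈ ringConfigs P L) (hY : Y ∈ ringConfigs P L) {n : Fin P → ℤ}
    {σ : Equiv.Perm (Fin P)}
    (h : ∀ i, ringMatrix L (mixedRows (weightedF v q 0) (weightedF₀ v q) (tailParticles L X) X)
      Y n i (σ i) ≠ 0) : X = Y ∧ n = 0 ∧ σ = 1 := by
  rcases Nat.eq_zero_or_pos P with rfl | hP
  · exact ⟨Subsingleton.elim _ _, Subsingleton.elim _ _, Subsingleton.elim _ _⟩
  obtain ⟨x, hx, hx', hxle⟩ := exists_extension hP hPL hX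
  obtain ⟨y, hy, hy', hyle⟩ := exists_extension hP hPL hY
  obtain ⟨N, hN⟩ : ∃ N, N = ∑ k, n k := ⟨_, rfl⟩
  obtain ⟨I, hI⟩ : ∃ I : Fin P → ℤ, ∀ i, I i = i + P * n i := ⟨_, fun _ => rfl⟩
  obtain ⟨J, hJ⟩ : ∃ J : Fin P → ℤ, ∀ i, J i = ((σ i : ℕ) : ℤ) + N := ⟨_, fun _ => rfl⟩
  obtain ⟨u, hu⟩ : ∃ u : ℤ → ℤ, ∀ k, u k = x k - k := ⟨_, fun _ => rfl⟩
  obtain ⟨w, hw⟩ : ∃ w : ℤ → ℤ, ∀ k, w k = y (k - N) - k := ⟨_, fun _ => rfl⟩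
  have hP' : (P : ℤ) ≠ 0 := by exact_mod_cast hP.ne'
  have humono : Monotone u := fun k l hkl => by
    have := hxle k l hkl
    rw [hu, hu]
    omega
  have hwmono : Monotone w := fun k l hkl => by
    have := hyle (k - N) (l - N) (by omega)
    rw [hw, hw]
    omega
  have hIsum : ∀ k, ∑ i, (I i - k) / P = N - k := fun k => by
    have : ∀ i, (I i - k) / P = ((i : ℤ) + -k) / P + n i := fun i => by
      rw [hI, show (i : ℤ) + P * n i - k = (i : ℤ) + -k + P * n i by ring,
        Int.add_mul_ediv_left _ _ hP']
    simp only [this, sum_add_distrib]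
    rw [sum_fin_add_ediv hP, hN]
    ring
  have hJsum : ∀ k, ∑ i, (J i - k) / P = N - k := fun k => by
    have : ∀ i, (J i - k) / P = (((σ i : ℕ) : ℤ) + (N - k)) / P := fun i => by
      rw [hJ, add_sub_assoc]
    simp only [this]
    rw [Equiv.sum_comp σ (fun i : Fin P => ((i : ℤ) + (N - k)) / P), sum_fin_add_ediv hP]
  -- the particle at the label `I i` is last in its cluster if and only if `u` increases there
  have htail : ∀ i, i ∈ tailParticles L X ↔ u (I i - 1) < u (I i) := by
    intro i
    constructor
    · intro hi
      refine lt_of_le_of_ne (humono (by omega)) fun heq => ?_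
      rw [hu, hu] at heq
      have h1 := Int.emod_nonneg (I i - 1) hP'
      have h2 := Int.emod_lt_of_pos (I i - 1) (show (0 : ℤ) < P by omega)
      obtain ⟨k, m, hkm⟩ : ∃ (k : Fin P) (m : ℤ), I i - 1 = k + P * m :=
        ⟨⟨((I i - 1) % P).toNat, by omega⟩, (I i - 1) / P, by
          push_cast
          rw [Int.toNat_of_nonneg h1, Int.emod_add_mul_ediv]⟩
      have e1 := hx k m
      rw [← hkm] at e1
      have e2 := hx i (n i)
      rw [← hI] at e2
      have e3 : X k = X i - 1 + (n i - m) * L := by linarith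
      exact mem_tailParticles.mp hi k (by rw [e3]; push_cast; simp)
    · intro hlt
      rw [mem_tailParticles]
      intro k hk
      obtain ⟨-, c, hc1, hc2⟩ := neighbour_label hPL hX hk
      have e1 := hx k (n i - c)
      rw [show (k : ℤ) + P * (n i - c) = I i - 1 by rw [hI]; linear_combination -hc1] at e1
      have e2 := hx i (n i)
      rw [← hI] at e2
      have e3 : x (I i - 1) = x (I i) - 1 := by
        rw [e1, e2]
        linear_combination -hc2
      rw [hu, hu] at hlt
      omega
  have hentry : ∀ i, (if i ∈ tailParticles L X then weightedF v q 0 else weightedF₀ v q)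
      (I i - J i) (I i - J i + (u (I i) - w (J i))) ≠ 0 := fun i => by
    have := h i
    rw [ringMatrix, Matrix.of_apply, mixedRows] at this
    convert this using 2
    · rw [hI, hJ, hN]
      ring
    · have e1 := hx i (n i)
      have e2 := hy (σ i) 0
      rw [← hI] at e1
      rw [mul_zero, add_zero, zero_mul, add_zero] at e2
      rw [hu, hw, show J i - N = ((σ i : ℕ) : ℤ) by rw [hJ]; ring, e1, e2]
      ring
  have h1 : ∀ i, I i ≤ J i → w (J i) ≤ u (I i) := by
    intro i hi
    by_contra hc
    refine hentry i ?_
    split_ifs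
    · rw [weightedF, tasepF_eq_zero_of_lt v 0 (by omega) (by omega), mul_zero]
    · rw [weightedF₀, tasepF₀_eq_zero_of_lt v (by omega) (by omega), mul_zero]
  have h2 : ∀ i, u (I i - 1) < u (I i) → J i ≤ I i → u (I i) ≤ w (J i) := by
    intro i hi hJI
    by_contra hc
    refine hentry i ?_
    rw [if_pos ((htail i).mpr hi), weightedF,
      tasepF_eq_zero_of_gt v (by push_cast; omega) (by push_cast; omega), mul_zero]
  have h3 : ∀ i, ¬ u (I i - 1) < u (I i) → J i < I i → u (I i) < w (J i) := by
    intro i hi hJI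
    by_contra hc
    refine hentry i ?_
    rw [if_neg (mt (htail i).mp hi), weightedF₀,
      tasepF₀_eq_zero_of_ge hv (by omega) (by omega), mul_zero]
  have huw : ∀ k, u k = w k := eq_of_matching hP (D := L - P) (by omega) humono hwmono
    (fun k m => by rw [hu, hu, hx']; ring)
    (fun k m => by
      rw [hw, hw, show k + P * m - N = k - N + P * m by ring, hy']
      ring)
    hIsum hJsum h1
    (fun i hi => by
      by_cases ht : u (I i - 1) < u (I i)
      · exact h2 i ht hi.le
      · exact (h3 i ht hi).le)
    (fun i ht hi => h2 i ht hi.ge)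
  have hxy : ∀ k, x k = y (k - N) := fun k => by
    have := huw k
    rw [hu, hw] at this
    omega
  have hXc := mem_ringConfigs.mp hX
  have hYc := mem_ringConfigs.mp hY
  -- both configurations lie between `1` and `L`
  have hN0 : N = 0 := by
    have key : ∀ {x y : ℤ → ℤ} {X Y : Fin P → ℤ} {N : ℤ},
        (∀ (i : Fin P) (n : ℤ), x (i + P * n) = X i + n * L) →
        (∀ (i : Fin P) (n : ℤ), y (i + P * n) = Y i + n * L) →
        (∀ I J, I ≤ J → J - I ≤ x J - x I) →
        (∀ i, 1 ≤ X i ∧ X i ≤ L) → (∀ i, 1 ≤ Y i ∧ Y i ≤ L) → (∀ k, x k = y (k - N)) → 0 ≤ N := by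
      intro x y X Y N hx hy hxle hX hY hxy
      by_contra hc
      have e1 := hx ⟨P - 1, by omega⟩ (-1)
      have e2 := hy ⟨0, hP⟩ 0
      have e3 := hxle N (-1) (by omega)
      have e4 := hxy N
      have := (hX ⟨P - 1, by omega⟩).2
      have := (hY ⟨0, hP⟩).1
      push_cast [Nat.cast_sub (show 1 ≤ P by omega)] at e1
      rw [show (P : ℤ) - 1 + P * -1 = -1 by ring] at e1
      simp only [Nat.cast_zero, mul_zero, add_zero, zero_mul] at e2
      rw [sub_self] at e4
      linarith
    refine le_antisymm ?_ (key hx hy hxle hXc.1 hYc.1 hxy)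
    have := key (N := -N) hy hx hyle hYc.1 hXc.1 fun k => by
      rw [hxy, sub_neg_eq_add, add_sub_cancel_right]
    omega
  have hle : ∀ i, I i ≤ J i := by
    intro i
    by_contra hc
    have e1 := humono (show J i ≤ I i - 1 by omega)
    have e2 := humono (show I i - 1 ≤ I i by omega)
    by_cases ht : u (I i - 1) < u (I i)
    · have := h2 i ht (by omega)
      rw [← huw] at this
      omega
    · have := h3 i ht (by omega)
      rw [← huw] at this
      omega
  have hIJ : ∀ i, I i = J i := by
    have hs : ∑ i, I i = ∑ i, J i := by
      simp only [hI, hJ, hN0, add_zero, sum_add_distrib, ← mul_sum]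
      rw [Equiv.sum_comp σ (fun i : Fin P => ((i : ℕ) : ℤ)), ← hN, hN0]
      ring
    intro i
    exact (sum_eq_sum_iff_of_le fun i _ => hle i).mp hs i (mem_univ i)
  have hn : ∀ i, n i = 0 := by
    intro i
    have e := hIJ i
    rw [hI, hJ, hN0] at e
    have h1 := i.isLt
    have h2 := (σ i).isLt
    rcases lt_trichotomy (n i) 0 with h0 | h0 | h0
    · nlinarith
    · exact h0
    · nlinarith
  refine ⟨?_, funext hn, ?_⟩
  · funext i
    have e1 := hx i 0
    have e2 := hy i 0
    rw [hxy, hN0, sub_zero, e2] at e1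
    linarith
  · ext i
    have e := hIJ i
    rw [hI, hJ, hN0, hn] at e
    simp only [Equiv.Perm.coe_one, id_eq]
    omega

/-- At time `0` the eliminated rows leave the identity permutation without winding, where each
particle that is not last in its cluster contributes a factor `(1 - v)⁻¹`. -/
lemma weightedRingF_zero {P L : ℕ} (hPL : P < L) {v q : ℝ} (hv : v < 1) (hq : q ≠ 0)
    {X Y : Fin P → ℤ} (hX : X ∈ ringConfigs P L) (hY : Y ∈ ringConfigs P L) :
    weightedRingF L v q X Y 0 =
      if X = Y then (1 - v) ^ ((numClusters L X : ℤ) - (P : ℤ)) else 0 := by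
  rw [weightedRingF, ← mixedRows_univ _ (weightedF₀ v q), ringSum_mixedRows_univ hPL
    (weightedF_zero_eq_add hq) (weightedF_stronglyBanded v q 0) (weightedF₀_banded hv q) hX,
    ringSum]
  set Φ := mixedRows (weightedF v q 0) (weightedF₀ v q) (tailParticles L X) X with hΦ
  have hzero : ∀ n (σ : Equiv.Perm (Fin P)), ¬(X = Y ∧ n = 0 ∧ σ = 1) →
      ∏ i, ringMatrix L Φ Y n i (σ i) = 0 := by
    intro n σ hne
    by_contra hc
    rw [prod_eq_zero_iff] at hc
    push Not at hc
    exact hne (eq_of_forall_ne_zero hPL hv q hX hY fun i => hc i (mem_univ i))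
  split_ifs with hXY
  · subst hXY
    have hsum : ∀ n ≠ 0, ringSummand L Φ X n = 0 := by
      intro n hn
      rw [ringSummand_eq_sum_perm]
      exact sum_eq_zero fun σ _ => by rw [hzero n σ fun h => hn h.2.1, mul_zero, mul_zero]
    rw [tsum_eq_single 0 hsum, ringSummand_eq_sum_perm, sum_eq_single 1]
    · have hent : ∀ i, ringMatrix L Φ X 0 i i =
          if i ∈ (tailParticles L X)ᶜ then (1 - v)⁻¹ else 1 := by
        intro i
        simp only [ringMatrix, hΦ, mixedRows, Matrix.of_apply, Pi.zero_apply, mem_compl]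
        by_cases hi : i ∈ tailParticles L X
        · simp [hi, weightedF, tasepF_zero_zero_zero]
        · simp [hi, weightedF₀, tasepF₀_zero_zero hv]
      have hcard := card_compl (tailParticles L X)
      have hle := card_le_univ (tailParticles L X)
      rw [Fintype.card_fin] at hcard hle
      simp only [Equiv.Perm.coe_one, id_eq, hent, prod_ite_mem, univ_inter, prod_const,
        Pi.zero_apply, sum_const_zero, mul_zero, zpow_zero, Equiv.Perm.sign_one, Units.val_one, Int.cast_one,
        one_mul]
      rw [numClusters_eq_card_tailParticles hX, inv_pow, ← zpow_natCast, ← zpow_neg, hcard,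
        Nat.cast_sub hle, neg_sub]
    · intro σ _ hσ
      rw [hzero 0 σ fun h => hσ h.2.2, mul_zero, mul_zero]
    · simp
  · refine (tsum_congr fun n => ?_).trans tsum_zero
    rw [ringSummand_eq_sum_perm]
    exact sum_eq_zero fun σ _ => by rw [hzero n σ fun h => hXY h.1, mul_zero, mul_zero]

/-! ### The determinant of the infinite lattice -/

lemma detInf_self {P : ℕ} {v : ℝ} (hv : v < 1) {X : Fin P → ℤ} (hX : StrictMono X) :
    detInf v X X 0 = (1 - v) ^ ((numClustersInf X : ℤ) - (P : ℤ)) := by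
  rcases P with _ | p
  · simp [detInf, numClustersInf]
  -- eliminate the row of the particle just behind from the row of each particle
  let M : Matrix (Fin (p + 1)) (Fin (p + 1)) ℝ := Matrix.of fun i j =>
    (if ∃ k, X k = X i - 1 then tasepF₀ v ((i : ℤ) - j) (X i - X j)
      else tasepF v ((i : ℤ) - j) (X i - X j) 0)
  have hpred : ∀ (i : Fin p), (∃ k, X k = X i.succ - 1) ↔ X i.castSucc = X i.succ - 1 := by
    refine fun i => ⟨fun ⟨k, hk⟩ => ?_, fun h => ⟨_, h⟩⟩
    have h1 : k < i.succ := hX.lt_iff_lt.mp (by omega)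
    have h2 := hX.monotone (Fin.le_castSucc_iff.mpr h1)
    have h3 := hX (Fin.castSucc_lt_succ (i := i))
    omega
  have hM : detInf v X X 0 = M.det := by
    refine Matrix.det_eq_of_forall_row_eq_smul_add_pred
      (fun i => if X i.castSucc = X i.succ - 1 then v / (1 - v) else 0) (fun j => ?_)
      fun i j => ?_
    · have : ¬∃ k, X k = X 0 - 1 := by
        rintro ⟨k, hk⟩
        have := hX.monotone (Fin.zero_le k)
        omega
      simp [M, this]
    · simp only [M, Matrix.of_apply, hpred]
      split_ifs with h
      · rw [tasepF₀, h]
        have e1 : (((i.succ : Fin (p + 1)) : ℕ) : ℤ) - (j : ℕ) - 1 =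
            ((i.castSucc : Fin (p + 1)) : ℕ) - (j : ℕ) := by
          push_cast [Fin.val_succ, Fin.val_castSucc]
          ring
        rw [e1, show X i.succ - X j - 1 = X i.succ - 1 - X j by ring]
        ring
      · ring
  have htri : M.IsUpperTriangular := by
    intro i j hij
    have hij' : j < i := hij
    have hlt : (j : ℕ) < i := hij'
    have hle := strictMono_sub_le hX hij'.le
    simp only [M, Matrix.of_apply]
    split_ifs with h
    · exact tasepF₀_eq_zero_of_ge hv (by omega) (by omega)
    · refine tasepF_eq_zero_of_gt v (by push_cast; omega) ?_
      by_contra hc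
      -- all sites between the two particles would be occupied
      obtain ⟨m, rfl⟩ : ∃ m : Fin p, i = m.succ :=
        ⟨i.pred (Fin.ne_zero_of_lt hij'), (Fin.succ_pred _ _).symm⟩
      have h1 := strictMono_sub_le hX (Fin.le_castSucc_iff.mpr hij')
      have h2 := hX (Fin.castSucc_lt_succ (i := m))
      rw [hpred] at h
      push_cast [Fin.val_succ, Fin.val_castSucc] at h1 hle hc
      omega
  rw [hM, Matrix.det_of_isUpperTriangular htri]
  have hent : ∀ i, M i i = if i ∈ ({i | ∃ k, X k = X i - 1} : Finset (Fin (p + 1))) then (1 - v)⁻¹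
      else 1 := by
    intro i
    simp only [M, Matrix.of_apply, sub_self, mem_filter, mem_univ, true_and, tasepF₀_zero_zero hv,
      tasepF_zero_zero_zero]
  -- the particles with an occupied site behind them and those with an occupied site ahead
  have hcard : ({i | ∃ k, X k = X i - 1} : Finset (Fin (p + 1))).card =
      ({i | ∃ k, X k = X i + 1} : Finset (Fin (p + 1))).card := by
    refine card_bij (fun i hi => (mem_filter.mp hi).2.choose) ?_ ?_ ?_
    · intro i hi
      have := (mem_filter.mp hi).2.choose_spec
      exact mem_filter.mpr ⟨mem_univ _, i, by omega⟩
    · intro i hi j hj hij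
      have h1 := (mem_filter.mp hi).2.choose_spec
      have h2 := (mem_filter.mp hj).2.choose_spec
      rw [hij] at h1
      exact hX.injective (by omega)
    · intro k hk
      obtain ⟨i, hi⟩ := (mem_filter.mp hk).2
      have hi' : i ∈ ({i | ∃ k, X k = X i - 1} : Finset (Fin (p + 1))) :=
        mem_filter.mpr ⟨mem_univ _, k, by omega⟩
      refine ⟨i, hi', hX.injective ?_⟩
      rw [(mem_filter.mp hi').2.choose_spec]
      omega
  have hcompl : ({i | ∃ k, X k = X i + 1} : Finset (Fin (p + 1))).card + numClustersInf X =
      p + 1 := by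
    have := card_filter_add_card_filter_not (s := (univ : Finset (Fin (p + 1))))
      (fun i => ∃ k, X k = X i + 1)
    simpa [numClustersInf] using this
  simp only [hent, prod_ite_mem, univ_inter, prod_const]
  rw [hcard, inv_pow, ← zpow_natCast, ← zpow_neg]
  congr 1
  push_cast
  have : ((#{i | ∃ k, X k = X i + 1} : ℕ) : ℤ) + numClustersInf X = p + 1 := by
    exact_mod_cast hcompl
  linarith

/-! ### The Markov equation -/

lemma sum_jumpSets_zero {L : ℕ} {X : Fin 0 → ℤ} (hX : X ∈ ringConfigs 0 L)
    (g : (Fin 0 → ℤ) → ℕ → ℝ) :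
    ∑ X' ∈ ringConfigs 0 L, ∑ S' ∈ jumpSets L X X', g X' S'.card =
      ∑ S ∈ (tailParticles L X).powerset, g (moveBack X S) S.card := by
  have h1 : ringConfigs 0 L = {X} :=
    eq_singleton_iff_unique_mem.mpr ⟨hX, fun _ _ => Subsingleton.elim _ _⟩
  have h2 : jumpSets L X X = {∅} := by
    refine eq_singleton_iff_unique_mem.mpr ⟨?_, fun S _ => eq_empty_of_isEmpty S⟩
    simp [mem_jumpSets]
  rw [h1, sum_singleton, h2, sum_singleton, eq_empty_of_isEmpty (tailParticles L X),
    powerset_empty, sum_singleton, Subsingleton.elim (moveBack X ∅) X]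

lemma jumpWeight_eq {P L : ℕ} (v : ℝ) {X' : Fin P → ℤ} {S : Finset (Fin P)}
    (hS : S ⊆ frontParticles L X') :
    jumpWeight L v X' S = v ^ S.card * (1 - v) ^ (frontParticles L X' \ S).card := by
  rw [jumpWeight, prod_ite, prod_const, prod_const, filter_mem_eq_inter,
    inter_eq_right.mpr hS, filter_notMem_eq_sdiff]

/-- After division by the stationary factor, the determinants satisfy the Markov equation, the
transition probability from `X'` to `X` being split according to the particles that jump. -/
lemma weightedRingF_div_succ {P L : ℕ} (hPL : P < L) {v q : ℝ} (hv : v < 1) (hq : q ≠ 0)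
    {X : Fin P → ℤ} (hX : X ∈ ringConfigs P L) (Y : Fin P → ℤ) (t : ℕ) :
    weightedRingF L v q X Y (t + 1) / (1 - v) ^ ((numClusters L X : ℤ) - (P : ℤ)) =
      ∑ X' ∈ ringConfigs P L, ∑ S ∈ jumpSets L X X', q ^ S.card * jumpWeight L v X' S *
        (weightedRingF L v q X' Y t / (1 - v) ^ ((numClusters L X' : ℤ) - (P : ℤ))) := by
  have hv' : 1 - v ≠ 0 := by linarith
  have key : ∀ (U S : Finset (Fin P)), S ⊆ U → (1 - v) ^ (U \ S).card =
      (1 - v) ^ ((P : ℤ) - S.card) * (1 - v) ^ ((U.card : ℤ) - P) := by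
    intro U S hS
    rw [← zpow_add₀ hv', ← zpow_natCast, card_sdiff_of_subset hS, Nat.cast_sub (card_le_card hS)]
    congr 1
    ring
  let g : (Fin P → ℤ) → ℕ → ℝ := fun Z m =>
    (1 - v) ^ ((P : ℤ) - m) * (v * q) ^ m * weightedRingF L v q Z Y t
  have hleft : weightedRingF L v q X Y (t + 1) / (1 - v) ^ ((numClusters L X : ℤ) - (P : ℤ)) =
      ∑ S ∈ (tailParticles L X).powerset, g (moveBack X S) S.card := by
    rw [weightedRingF_succ hPL hv hq hX, sum_div]
    refine sum_congr rfl fun S hS => ?_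
    rw [key _ _ (mem_powerset.mp hS), numClusters_eq_card_tailParticles hX]
    have := zpow_ne_zero (((tailParticles L X).card : ℤ) - P) hv'
    field_simp
    rfl
  have hright : ∀ X' ∈ ringConfigs P L, ∀ S ∈ jumpSets L X X', q ^ S.card * jumpWeight L v X' S *
      (weightedRingF L v q X' Y t / (1 - v) ^ ((numClusters L X' : ℤ) - (P : ℤ))) =
        g X' S.card := by
    intro X' _ S hS
    rw [mem_jumpSets] at hS
    rw [jumpWeight_eq v hS.1, key _ _ hS.1, numClusters]
    have := zpow_ne_zero (((frontParticles L X').card : ℤ) - P) hv'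
    simp only [g]
    rw [mul_pow]
    field_simp
  rw [hleft, sum_congr rfl fun X' hX' => sum_congr rfl fun S hS => hright X' hX' S hS]
  rcases P with _ | p
  · exact (sum_jumpSets_zero hX g).symm
  · refine (sum_jumpSets_succ hPL hX g fun Z m => ?_).symm
    simp only [g]
    congr 1
    exact ringSum_relabel L (weightedF v q t) Z Y

lemma transProb_eq {P L : ℕ} (hPL : P < L) {v : ℝ} (hv : v < 1) {X₀ : Fin P → ℤ}
    (hX₀ : X₀ ∈ ringConfigs P L) (t : ℕ) {X : Fin P → ℤ} (hX : X ∈ ringConfigs P L) :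
    transProb L v X₀ t X =
      weightedRingF L v 1 X X₀ t / (1 - v) ^ ((numClusters L X : ℤ) - (P : ℤ)) := by
  have hv' : 1 - v ≠ 0 := by linarith
  induction t generalizing X with
  | zero =>
    rw [transProb, weightedRingF_zero hPL hv one_ne_zero hX hX₀]
    split_ifs
    · rw [div_self (zpow_ne_zero _ hv')]
    · rw [zero_div]
  | succ t ih =>
    rw [transProb, weightedRingF_div_succ hPL hv one_ne_zero hX]
    refine sum_congr rfl fun X' hX' => ?_
    rw [ih hX', stepProb, sum_mul]
    simp only [one_pow, one_mul]

lemma hasSum_jointProb {P L : ℕ} (hPL : P < L) {v q : ℝ} (hv : v < 1) (hq : q ≠ 0)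
    {X₀ : Fin P → ℤ} (hX₀ : X₀ ∈ ringConfigs P L) (t : ℕ) {X : Fin P → ℤ}
    (hX : X ∈ ringConfigs P L) :
    HasSum (fun J : ℕ => q ^ J * jointProb L v X₀ t X J)
      (weightedRingF L v q X X₀ t / (1 - v) ^ ((numClusters L X : ℤ) - (P : ℤ))) := by
  have hv' : 1 - v ≠ 0 := by linarith
  induction t generalizing X with
  | zero =>
    rw [weightedRingF_zero hPL hv hq hX hX₀]
    convert hasSum_single (f := fun J : ℕ => q ^ J * jointProb L v X₀ 0 X J) 0 fun J hJ => by
      simp [jointProb, hJ] using 1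
    by_cases h : X = X₀
    · simp [jointProb, h, zpow_ne_zero _ hv']
    · simp [jointProb, h]
  | succ t ih =>
    rw [weightedRingF_div_succ hPL hv hq hX]
    simp only [jointProb, mul_sum]
    refine hasSum_sum fun X' hX' => hasSum_sum fun S _ => ?_
    -- the distance travelled before the last step is `J - S.card`
    have hinj : Function.Injective fun J : ℕ => J + S.card := fun _ _ h => Nat.add_right_cancel h
    rw [← hinj.hasSum_iff]
    · refine ((ih hX').mul_left (q ^ S.card * jumpWeight L v X' S)).congr_fun ?_
      intro J
      simp only [Function.comp_apply, Nat.le_add_left, if_true, Nat.add_sub_cancel, pow_add]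
      ring
    · intro J hJ
      rw [if_neg, mul_zero]
      exact fun hle => hJ ⟨J - S.card, Nat.sub_add_cancel hle⟩

theorem mainTheorem1 (P L : ℕ) (hPL : P < L) (v : ℝ) (hv0 : 0 ≤ v) (hv1 : v < 1) :
    -- only finitely many summands are nonzero
    (∀ X ∈ ringConfigs P L, ∀ Y ∈ ringConfigs P L, ∀ t : ℕ,
      {n : Fin P → ℤ | ringTerm L v X Y t n ≠ 0}.Finite) ∧
    -- the denominator, on the ring and on the infinite lattice
    (∀ X ∈ ringConfigs P L,
      ringF L v X X 0 = (1 - v) ^ ((numClusters L X : ℤ) - (P : ℤ))) ∧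
    (∀ X : Fin P → ℤ, StrictMono X →
      detInf v X X 0 = (1 - v) ^ ((numClustersInf X : ℤ) - (P : ℤ))) ∧
    -- the transition probability
    (∀ X₀ ∈ ringConfigs P L, ∀ X ∈ ringConfigs P L, ∀ t : ℕ,
      transProb L v X₀ t X = ringF L v X X₀ t / ringF L v X X 0) ∧
    -- the generating function of configurations jointly with the total distance travelled
    (∀ X₀ ∈ ringConfigs P L, ∀ X ∈ ringConfigs P L, ∀ (t : ℕ) (γ : ℝ),
      HasSum (fun J : ℕ => Real.exp (γ * J) * jointProb L v X₀ t X J)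
        (ringGenF L v γ X X₀ t / ringF L v X X 0)) := by
  have hF : ∀ X ∈ ringConfigs P L,
      ringF L v X X 0 = (1 - v) ^ ((numClusters L X : ℤ) - (P : ℤ)) := fun X hX => by
    rw [← weightedRingF_one, weightedRingF_zero hPL hv1 one_ne_zero hX hX, if_pos rfl]
  refine ⟨fun X _ Y _ t => ?_, hF, fun X hX => detInf_self hv1 hX, fun X₀ hX₀ X hX t => ?_,
    fun X₀ hX₀ X hX t γ => ?_⟩
  · have hb : RingBanded fun (i : Fin P) a b => weightedF v 1 t a (X i + b) :=
      ringBanded_shift X (fun _ => (weightedF_stronglyBanded v 1 t).rowBanded)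
        fun hP => ⟨⟨0, Nat.pos_of_ne_zero hP⟩, weightedF_stronglyBanded v 1 t⟩
    refine (finite_support_ringSummand hPL hb Y).subset fun n hn => ?_
    rw [Set.mem_ofPred_eq, ringSummand_weightedF L v one_ne_zero, one_zpow, one_mul]
    exact hn
  · rw [hF X hX, transProb_eq hPL hv1 hX₀ t hX, weightedRingF_one]
  · have h := hasSum_jointProb hPL hv1 (Real.exp_ne_zero γ) hX₀ t hX
    rw [weightedRingF_exp, ← hF X hX] at h
    refine h.congr_fun fun J => ?_
    rw [← Real.exp_nat_mul, mul_comm γ]
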